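/- **Setting.** Let $d\ge 1$ and let $\Omega\subset\mathbb R^d$ be a bounded domain with a conforming triangulation $\mathcal T$ into finitely many open simplices (the simplices lie in $\Omega$, their closures cover $\overline\Omega$, and the closures of any two of them meet in a common subsimplex, possibly empty). A facet lies in $\partial\Omega$ or, otherwise, belongs to the interior skeleton $\mathscr E$. Let $V_h$ be the space of piecewise polynomials of degree at most $p$, $\mathring V_h\subset V_h$ the subspace of functions with zero trace on the facets in $\partial\Omega$, and $V_h^{\boldsymbol n}\subset V_h^d$ the subspace of fields with zero normal trace on the facets in $\partial\Omega$. For a piecewise polynomial field $w$ let $[\![w]\!]=\sum_{K} w|_K\cdot n_K$ on a facet in $\mathscr E$, summed over the adjacent elements $K$ with outward unit normals $n_K$. Differential operators act elementwise, $\int_\Omega=\sum_K\int_K$. Let $W\in C^1(\mathbb R)$, $\mu,\gamma\in\mathbb R$, and let $B_h$ be a bilinear form on $\mathring V_h^d$. The fluxes $F_i(\rho,v,\tau,q,\cdot)$ are defined for $(\rho,v,\tau,q)\in V_h\times\mathring V_h^d\times V_h\times V_h^{\boldsymbol n}$, take values in $L^2(\mathscr E)$, and are linear in the test function, which lies in $V_h$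 for $i=1,3$, in $\mathring V_h^d$ for $i=2$, and in $V_h^{\boldsymbol n}$ for $i=4$. **Scheme.** Let $0=t_0<\dots<t_N$, $k_n=t_{n+1}-t_n$, $f^{n+1/2}=\frac12(f^n+f^{n+1})$. Given $(\rho^0,v^0,\tau^0,q^0)$ in $V_h\times\mathring V_h^d\times V_h\times V_h^{\boldsymbol n}$, let $(\rho^{n+1},v^{n+1},\tau^{n+1},q^{n+1})$, $0\le n<N$, in the same space satisfy, for all $\Psi,\Xi\in V_h$, $\chi\in\mathring V_h^d$, $\zeta\in V_h^{\boldsymbol n}$, with $(\rho,v,\tau,q)$ short for $(\rho,v,\tau,q)^{n+1/2}$, $$0=\int_\Omega\Big(\tfrac{\rho^{n+1}-\rho^n}{k_n}+\operatorname{div}(\rho v)\Big)\Psi\,dx+\int_{\mathscr E}F_1(\rho,v,\tau,q,\Psi)\,ds,\tag{1}$$ $$0=\int_\Omega\Big(\rho\,\tfrac{v^{n+1}-v^n}{k_n}+\operatorname{div}(\rho v\otimes v)-\operatorname{div}(\rho v)v+\rho\nabla\tau-\tfrac12\rho\nabla|v|^2\Big)\cdot\chi\,dx+\int_{\mathscr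 E}F_2(\rho,v,\tau,q,\chi)\,ds+\mu B_h(v,\chi),\tag{2}$$ $$0=\int_\Omega\Big(\tau-\tfrac{W(\rho^{n+1})-W(\rho^n)}{\rho^{n+1}-\rho^n}+\gamma\operatorname{div}q-\tfrac14\big(|v^{n+1}|^2+|v^n|^2\big)\Big)\Xi\,dx+\int_{\mathscr E}F_3(\rho,v,\tau,q,\Xi)\,ds,\tag{3}$$ $$0=\int_\Omega(q^{n+1}-\nabla\rho^{n+1})\cdot\zeta\,dx+\int_{\mathscr E}F_4(\rho^{n+1},v^{n+1},\tau^{n+1},q^{n+1},\zeta)\,ds,\tag{4}$$ where the difference quotient of $W$ is read as $W'(\rho^n)$ at points where $\rho^{n+1}=\rho^n$. **Assumptions on the fluxes.** * (mass) $\int_{\mathscr E}F_1(\rho,v,\tau,q,1)\,ds=-\int_{\mathscr E}[\![\rho v]\!]\,ds$ for all discrete $(\rho,v,\tau,q)$; * (energy) for all time-differentiable $(\rho,v,\tau,q)$ with values in $V_h\times\mathring V_h^d\times V_h\times V_h^{\boldsymbol n}$ and all $t\in[0,t_N]$, $$\int_{\mathscr E}F_1(\rho,v,\tau,q,\tau)+F_2(\rho,v,\tau,q,v)+[\![\rho\tau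 v]\!]\,ds=0,$$ $$\int_{\mathscr E}F_3(\rho,v,\tau,q,\partial_t\rho)-\gamma D_tF_4(\rho,v,\tau,q,q)+\gamma[\![\partial_t\rho\,q]\!]\,ds=0,$$ where $\int_{\mathscr E}D_tF_4(\rho,v,\tau,q,Z)\,ds$ is the time derivative of $\int_{\mathscr E}F_4(\rho(t),v(t),\tau(t),q(t),Z)\,ds$ for a time-independent $Z\in V_h^{\boldsymbol n}$ (assumed to exist), and $Z=q(t)$ is inserted afterwards; * $F_4$ is linear in its argument $\rho$ (with the other arguments fixed). **Theorem 5.1.** Every solution of the scheme satisfies $\int_\Omega\rho^n\,dx=\int_\Omega\rho^0\,dx$ for $0\le n\le N$. With $$E^n=\int_\Omega W(\rho^n)+\tfrac12\rho^n|v^n|^2+\tfrac\gamma2|q^n|^2\,dx,$$ it satisfies $$E^{n+1}-E^n=-\mu k_nB_h(v^{n+1/2},v^{n+1/2})$$ for $1\le n<N$, and also for $n=0<N$ if the initial data satisfy the discrete gradient equation $0=\int_\Omega(q^0-\nabla\rho^0)\cdot\zeta\,dx+\int_{\mathscr E}F_4(\rho^0,v^0,\tau^0,q^0,\zeta)\,ds$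 for all $\zeta\in V_h^{\boldsymbol n}$. -/

import Mathlib

namespace NSK

open MeasureTheory

/-- The Euclidean space `ℝ^d`. -/
abbrev Pt (d : ℕ) : Type := EuclideanSpace ℝ (Fin d)

/-- A conforming triangulation of `Ω ⊆ ℝ^d` into finitely many simplices. An element is given by its
set of `d + 1` affinely independent vertices; the open simplex is the interior of their convex hull,
the closed simplex is the convex hull. Conformity: two closed simplices meet exactly in the convex
hull of their common vertices, which is a (possibly empty) full subsimplex of both. -/
structure Triangulation {d : ℕ} (Ω : Set (Pt d)) where
  elements : Finset (Finset (Pt d))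
  card_eq : ∀ K ∈ elements, K.card = d + 1
  affineIndependent : ∀ K ∈ elements, AffineIndependent ℝ ((↑) : K → Pt d)
  conforming : ∀ K ∈ elements, ∀ J ∈ elements,
    convexHull ℝ (K : Set (Pt d)) ∩ convexHull ℝ (J : Set (Pt d)) =
      convexHull ℝ ((K : Set (Pt d)) ∩ (J : Set (Pt d)))
  open_subset : ∀ K ∈ elements, interior (convexHull ℝ (K : Set (Pt d))) ⊆ Ω
  covers : ⋃ K ∈ elements, convexHull ℝ (K : Set (Pt d)) = closure Ω

/-- `n` is the unit normal of the facet `e` of the simplex `K` that points out of `K`. -/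
def IsOutwardNormal {d : ℕ} (K e : Finset (Pt d)) (n : Pt d) : Prop :=
  ‖n‖ = 1 ∧ (∀ x ∈ e, ∀ y ∈ e, inner ℝ n (y - x) = 0) ∧
    ∀ x ∈ e, ∀ y ∈ K, y ∉ e → inner ℝ n (y - x) < 0

/-- The outward unit normal `n_K` on the facet `e` of the simplex `K`. -/
noncomputable def outwardNormal {d : ℕ} (K e : Finset (Pt d)) : Pt d :=
  Classical.epsilon (IsOutwardNormal K e)

/-- Surface measure on the facet with vertex set `e`: `(d - 1)`-dimensional Euclidean Hausdorff
measure restricted to the closed facet (counting measure on a point if `d = 1`). -/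
noncomputable def facetMeasure {d : ℕ} (e : Finset (Pt d)) : Measure (Pt d) :=
  (μHE[d - 1] : Measure (Pt d)).restrict (convexHull ℝ (e : Set (Pt d)))

namespace Triangulation

variable {d : ℕ} {Ω : Set (Pt d)} (T : Triangulation Ω)

open Classical in
/-- All facets of all elements; a facet is given by its `d` vertices. -/
noncomputable def facets : Finset (Finset (Pt d)) :=
  T.elements.biUnion fun K => K.powersetCard d

open Classical in
/-- The facets that lie on the boundary `∂Ω`. -/
noncomputable def boundaryFacets : Finset (Finset (Pt d)) :=
  T.facets.filter fun e => convexHull ℝ (e : Set (Pt d)) ⊆ frontier Ω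

open Classical in
/-- The interior skeleton `ℰ`: the facets that do not lie on `∂Ω`. -/
noncomputable def interfaces : Finset (Finset (Pt d)) :=
  T.facets.filter fun e => ¬ convexHull ℝ (e : Set (Pt d)) ⊆ frontier Ω

/-- Piecewise polynomials: one real polynomial in `d` variables on every element. -/
abbrev BrokenPoly : Type := T.elements → MvPolynomial (Fin d) ℝ

variable {T}

/-- The value at `x` of (the extension to all of `ℝ^d` of) the polynomial that `u` has on `K`. For
`x` in the closed simplex this is the value of `u`, or its trace from `K`. -/
noncomputable def val (u : T.BrokenPoly) (K : T.elements) (x : Pt d) : ℝ :=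
  MvPolynomial.eval (fun i => x i) (u K)

/-- Elementwise partial derivative `∂_{x_i}`. -/
noncomputable def dx (i : Fin d) (u : T.BrokenPoly) : T.BrokenPoly :=
  fun K => MvPolynomial.pderiv i (u K)

/-- Elementwise divergence. -/
noncomputable def div (w : Fin d → T.BrokenPoly) : T.BrokenPoly :=
  ∑ i, dx i (w i)

variable (T)

/-- `∫_Ω f dx` of an elementwise given function: the sum of the integrals over the open elements. -/
noncomputable def intΩ (f : T.elements → Pt d → ℝ) : ℝ :=
  ∑ K : T.elements, ∫ x in interior (convexHull ℝ ((K : Finset (Pt d)) : Set (Pt d))), f K x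

/-- The finite element space `V_h` of discontinuous piecewise polynomials of degree at most `p`. -/
noncomputable def fes (p : ℕ) : Submodule ℝ T.BrokenPoly :=
  Submodule.pi Set.univ fun _ => MvPolynomial.restrictTotalDegree (Fin d) ℝ p

/-- The subspace of `V_h` of the functions with vanishing trace on `∂Ω`. -/
noncomputable def fesZero (p : ℕ) : Submodule ℝ T.BrokenPoly where
  carrier := {u | u ∈ T.fes p ∧ ∀ K : T.elements, ∀ e ∈ T.boundaryFacets, e ⊆ (K : Finset (Pt d)) →
    ∀ x ∈ convexHull ℝ (e : Set (Pt d)), val u K x = 0}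
  add_mem' := by
    rintro a b ⟨ha, ha'⟩ ⟨hb, hb'⟩
    refine ⟨add_mem ha hb, fun K e he heK x hx => ?_⟩
    have h1 := ha' K e he heK x hx
    have h2 := hb' K e he heK x hx
    simp only [val] at h1 h2 ⊢
    simp [h1, h2]
  zero_mem' := ⟨zero_mem _, fun K e he heK x hx => by simp [val]⟩
  smul_mem' := by
    rintro c a ⟨ha, ha'⟩
    refine ⟨Submodule.smul_mem _ c ha, fun K e he heK x hx => ?_⟩
    have h1 := ha' K e he heK x hx
    simp only [val] at h1 ⊢
    simp [h1]

/-- The space of the vector fields in `V_h^d` whose normal trace vanishes on `∂Ω`. -/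
noncomputable def fesNormal (p : ℕ) : Submodule ℝ (Fin d → T.BrokenPoly) where
  carrier := {w | (∀ i, w i ∈ T.fes p) ∧ ∀ K : T.elements, ∀ e ∈ T.boundaryFacets,
    e ⊆ (K : Finset (Pt d)) → ∀ x ∈ convexHull ℝ (e : Set (Pt d)),
      ∑ i, val (w i) K x * outwardNormal (K : Finset (Pt d)) e i = 0}
  add_mem' := by
    rintro a b ⟨ha, ha'⟩ ⟨hb, hb'⟩
    refine ⟨fun i => add_mem (ha i) (hb i), fun K e he heK x hx => ?_⟩
    have h1 := ha' K e he heK x hx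
    have h2 := hb' K e he heK x hx
    simp only [val] at h1 h2 ⊢
    simp [add_mul, Finset.sum_add_distrib, h1, h2]
  zero_mem' := ⟨fun _ => zero_mem _, fun K e he heK x hx => by simp [val]⟩
  smul_mem' := by
    rintro c a ⟨ha, ha'⟩
    refine ⟨fun i => Submodule.smul_mem _ c (ha i), fun K e he heK x hx => ?_⟩
    have h1 := ha' K e he heK x hx
    simp only [val] at h1 ⊢
    simp [mul_assoc, ← Finset.mul_sum, h1]

/-- The constant function `1` as an element of `V_h`. -/
noncomputable def one (p : ℕ) : T.fes p :=
  ⟨1, by simp [fes, Submodule.mem_pi, MvPolynomial.mem_restrictTotalDegree]⟩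

variable {T}

open Classical in
/-- The jump of a vector field on the facet `e`: the sum of `w|_K · n_K` over the elements `K` that
have the facet `e` (two elements, for `e` in the interior). -/
noncomputable def jump (w : Fin d → T.BrokenPoly) (e : Finset (Pt d)) (x : Pt d) : ℝ :=
  ∑ K ∈ Finset.univ.filter (fun J : T.elements => e ⊆ (J : Finset (Pt d))),
    ∑ i, val (w i) K x * outwardNormal (K : Finset (Pt d)) e i

/-- `∫_ℰ ⟦w⟧ ds`. -/
noncomputable def intJump (w : Fin d → T.BrokenPoly) : ℝ :=
  ∑ e ∈ T.interfaces, ∫ x, jump w e x ∂(facetMeasure e)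

variable (T)

/-- `L²(ℰ)`, as the product of the spaces `L²(e)` over the interior facets `e`. -/
abbrev SkeletonL2 : Type :=
  (e : T.interfaces) → Lp ℝ 2 (facetMeasure (e : Finset (Pt d)))

variable {T}

/-- `∫_ℰ F ds` for `F ∈ L²(ℰ)`. -/
noncomputable def intE (F : T.SkeletonL2) : ℝ :=
  ∑ e : T.interfaces, ∫ x, F e x ∂(facetMeasure (e : Finset (Pt d)))

variable (T)

/-- The discrete unknowns `(ρ_h, v_h, τ_h, q_h)` at one time. -/
structure State (p : ℕ) where
  ρ : T.fes p
  v : Fin d → T.fesZero p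
  τ : T.fes p
  q : T.fesNormal p

/-- The numerical fluxes `F_1, …, F_4`: functions of the discrete unknowns and a test function, with
values in `L²(ℰ)`, linear in the test function. -/
structure Fluxes (p : ℕ) where
  F1 : T.State p → T.fes p →ₗ[ℝ] T.SkeletonL2
  F2 : T.State p → (Fin d → T.fesZero p) →ₗ[ℝ] T.SkeletonL2
  F3 : T.State p → T.fes p →ₗ[ℝ] T.SkeletonL2
  F4 : T.State p → T.fesNormal p →ₗ[ℝ] T.SkeletonL2

variable {T} {p : ℕ}

/-- The average of the values at two consecutive time levels. -/
noncomputable def State.half (X Y : T.State p) : T.State p where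
  ρ := (1 / 2 : ℝ) • (X.ρ + Y.ρ)
  v := (1 / 2 : ℝ) • (X.v + Y.v)
  τ := (1 / 2 : ℝ) • (X.τ + Y.τ)
  q := (1 / 2 : ℝ) • (X.q + Y.q)

/-- The product of a piecewise polynomial scalar and a piecewise polynomial vector field. -/
noncomputable def scale (u : T.BrokenPoly) (w : Fin d → T.BrokenPoly) : Fin d → T.BrokenPoly :=
  fun i => u * w i

/-- The components of `v_h`, as piecewise polynomials. -/
def State.vel (X : T.State p) : Fin d → T.BrokenPoly := fun i => X.v i

/-- The condition on `F_1` for the conservation of mass. -/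
def Fluxes.MassCondition (F : T.Fluxes p) : Prop :=
  ∀ X : T.State p, intE (F.F1 X (T.one p)) = - intJump (scale (X.ρ : T.BrokenPoly) X.vel)

/-- `u'` is the time derivative at `t` of the time dependent piecewise polynomial `u`. -/
def HasTimeDeriv (u : ℝ → T.BrokenPoly) (u' : T.BrokenPoly) (t : ℝ) : Prop :=
  ∀ (K : T.elements) (x : Pt d), HasDerivAt (fun s => val (u s) K x) (val u' K x) t

/-- The trajectory `X` of discrete unknowns is differentiable in time and `ρ'` is the time
derivative of its density. -/
def IsTrajectory (X : ℝ → T.State p) (ρ' : ℝ → T.fes p) : Prop :=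
  (∀ t, HasTimeDeriv (fun s => ((X s).ρ : T.BrokenPoly)) (ρ' t) t) ∧
  (∀ t i, ∃ w, HasTimeDeriv (fun s => (X s).vel i) w t) ∧
  (∀ t, ∃ w, HasTimeDeriv (fun s => ((X s).τ : T.BrokenPoly)) w t) ∧
  (∀ t i, ∃ w, HasTimeDeriv (fun s => ((X s).q : Fin d → T.BrokenPoly) i) w t)

/-- The two conditions on the fluxes for the conservation of energy, along all trajectories of
discrete functions. In `D_t F_4(ρ_h, v_h, τ_h, q_h, Z)` the test function `Z` is frozen, and `Z = q_h`
is put in after the differentiation. The condition includes that this time derivative exists. -/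
def Fluxes.EnergyCondition (F : T.Fluxes p) (γ tEnd : ℝ) : Prop :=
  ∀ (X : ℝ → T.State p) (ρ' : ℝ → T.fes p), IsTrajectory X ρ' → ∀ t ∈ Set.Icc 0 tEnd,
    intE (F.F1 (X t) (X t).τ) + intE (F.F2 (X t) (X t).v)
        + intJump (scale ((X t).ρ * (X t).τ : T.BrokenPoly) (X t).vel) = 0 ∧
    (∀ Z : T.fesNormal p, DifferentiableAt ℝ (fun s => intE (F.F4 (X s) Z)) t) ∧
    intE (F.F3 (X t) (ρ' t)) - γ * deriv (fun s => intE (F.F4 (X s) (X t).q)) t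
        + γ * intJump (scale (ρ' t : T.BrokenPoly) (X t).q) = 0

/-- The discrete mass balance of one time step of length `k` from `X` to `Y`. -/
def MassEq (F : T.Fluxes p) (k : ℝ) (X Y : T.State p) : Prop :=
  let M := X.half Y
  ∀ Ψ : T.fes p,
    T.intΩ (val (((1 / k) • (Y.ρ - X.ρ : T.BrokenPoly) + div (scale (M.ρ : T.BrokenPoly) M.vel))
      * (Ψ : T.BrokenPoly))) + intE (F.F1 M Ψ) = 0

/-- The discrete momentum balance of one time step of length `k` from `X` to `Y`. -/
def MomentumEq (F : T.Fluxes p) (B : LinearMap.BilinForm ℝ (Fin d → T.fesZero p)) (μ k : ℝ)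
    (X Y : T.State p) : Prop :=
  let M := X.half Y
  let ρ : T.BrokenPoly := M.ρ
  let τ : T.BrokenPoly := M.τ
  let v := M.vel
  ∀ χ : Fin d → T.fesZero p,
    T.intΩ (val (∑ j,
      (ρ * ((1 / k) • (Y.vel j - X.vel j)) + (∑ i, dx i (ρ * v i * v j)) - div (scale ρ v) * v j
        + ρ * dx j τ - (1 / 2 : ℝ) • (ρ * dx j (∑ i, v i ^ 2))) * (χ j : T.BrokenPoly)))
      + intE (F.F2 M χ) + μ * B M.v χ = 0

/-- The discrete equation for `τ_h` in one time step from `X` to `Y`. Here `dslope W a b` is the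
difference quotient `(W b - W a) / (b - a)`, and `W' a` if `b = a`. -/
def PotentialEq (F : T.Fluxes p) (W : ℝ → ℝ) (γ : ℝ) (X Y : T.State p) : Prop :=
  let M := X.half Y
  ∀ Ξ : T.fes p,
    T.intΩ (fun K x =>
      (val (M.τ : T.BrokenPoly) K x
        - dslope W (val (X.ρ : T.BrokenPoly) K x) (val (Y.ρ : T.BrokenPoly) K x)
        + γ * val (div (M.q : Fin d → T.BrokenPoly)) K x
        - 1 / 4 * ((∑ i, val (Y.vel i) K x ^ 2) + ∑ i, val (X.vel i) K x ^ 2))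
        * val (Ξ : T.BrokenPoly) K x)
      + intE (F.F3 M Ξ) = 0

/-- The discrete equation `q_h = ∇ρ_h` at one time level. -/
def GradientEq (F : T.Fluxes p) (X : T.State p) : Prop :=
  ∀ ζ : T.fesNormal p,
    T.intΩ (val (∑ i, ((X.q : Fin d → T.BrokenPoly) i - dx i (X.ρ : T.BrokenPoly))
      * (ζ : Fin d → T.BrokenPoly) i)) + intE (F.F4 X ζ) = 0

/-- `X 0, …, X N` solves the fully discrete scheme with the time levels `t 0, …, t N`. -/
def IsSolution (F : T.Fluxes p) (B : LinearMap.BilinForm ℝ (Fin d → T.fesZero p))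
    (W : ℝ → ℝ) (μ γ : ℝ) (N : ℕ) (t : ℕ → ℝ) (X : ℕ → T.State p) : Prop :=
  ∀ n < N, MassEq F (t (n + 1) - t n) (X n) (X (n + 1)) ∧
    MomentumEq F B μ (t (n + 1) - t n) (X n) (X (n + 1)) ∧
    PotentialEq F W γ (X n) (X (n + 1)) ∧
    GradientEq F (X (n + 1))

/-- The mass `∫_Ω ρ_h dx`. -/
noncomputable def State.mass (X : T.State p) : ℝ :=
  T.intΩ (val (X.ρ : T.BrokenPoly))

/-- The energy `∫_Ω W(ρ_h) + ½ ρ_h |v_h|² + (γ/2) |q_h|² dx`. -/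
noncomputable def State.energy (W : ℝ → ℝ) (γ : ℝ) (X : T.State p) : ℝ :=
  T.intΩ fun K x =>
    W (val (X.ρ : T.BrokenPoly) K x)
      + 1 / 2 * val (X.ρ : T.BrokenPoly) K x * (∑ i, val (X.vel i) K x ^ 2)
      + γ / 2 * ∑ i, val ((X.q : Fin d → T.BrokenPoly) i) K x ^ 2

end Triangulation

end NSK

/-! Mass is conserved because, tested with 1, the divergence in the mass equation integrates to the
jump integral of `ρ v`, which `MassCondition` cancels.

For the energy, write (ρ, v, τ, q) for the midpoint averages and δ for the increment over one step.
The mass equation is tested with τ, the momentum equation with v, the potential equation with δρ,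
and both gradient equations with q. Convection drops out since v·(v·∇)v = ½ v·∇|v|². The products of
increments and averages telescope exactly. What is left of the tested integrands is div(ρτv) and
div(δρ q), and the divergence theorem `intΩ_div_eq_intJump` turns these into jump integrals without
contribution from ∂Ω. The pointwise bookkeeping is in `energy_sub_energy`.

`EnergyCondition` must then cancel the flux terms, but it speaks of time derivatives, while the
scheme produces the difference of F_4 at two levels. The bridge is `F3_sub_F4`. If γ ≠ 0,
trajectories of constant density show that the integral of F_4 depends on ρ and the test function
only (`intE_F4_eq`). By linearity in ρ, the difference is then the derivative along the affine path
ρ + s δρ.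

The divergence theorem is proved on one simplex, first in the direction of an edge: Fubini along
lines parallel to the edge, the fundamental theorem of calculus on each line, and comparison of the
surface measures of the two faces met by these lines. The edges at a vertex span the space, so
linearity gives every direction. -/

section

open MeasureTheory

/-! ### Fubini's theorem along lines oblique to a hyperplane -/

section ObliqueFubini

variable {E : Type*} [NormedAddCommGroup E] [InnerProductSpace ℝ E] [FiniteDimensional ℝ E]
  [MeasurableSpace E] [BorelSpace E]

/-- The surface measure on the hyperplane through `p` with normal `n`. -/
noncomputable def hyperplaneMeasure (n p : E) : Measure E :=
  (μHE[Module.finrank ℝ E - 1] : Measure E).restrict {y | inner ℝ n (y - p) = 0}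

omit [MeasurableSpace E] [BorelSpace E] in
theorem finrank_orthogonal_unit {n : E} (hn : ‖n‖ = 1) :
    Module.finrank ℝ (ℝ ∙ n)ᗮ = Module.finrank ℝ E - 1 := by
  have h0 : n ≠ 0 := by rintro rfl; simp at hn
  have h1 := (ℝ ∙ n).finrank_add_finrank_orthogonal
  rw [finrank_span_singleton h0] at h1
  omega

/-- The inclusion of the translated orthogonal complement is an isometry, and isometries transport
Hausdorff measure. This form gives s-finiteness, needed for product measures. -/
theorem hyperplaneMeasure_eq_map {n : E} (hn : ‖n‖ = 1) (p : E) :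
    hyperplaneMeasure n p = (volume : Measure (ℝ ∙ n)ᗮ).map fun y : (ℝ ∙ n)ᗮ => p + (y : E) := by
  have hiso : Isometry fun y : (ℝ ∙ n)ᗮ => p + (y : E) :=
    (isometry_add_left p).comp isometry_subtype_coe
  rw [← InnerProductSpace.euclideanHausdorffMeasure_eq_volume, finrank_orthogonal_unit hn,
    hiso.map_euclideanHausdorffMeasure, hyperplaneMeasure]
  congr 1
  ext y
  simp only [Set.mem_ofPred_eq, Set.mem_range]
  constructor
  · intro h
    exact ⟨⟨y - p, Submodule.mem_orthogonal_singleton_iff_inner_right.2 h⟩, by simp⟩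
  · rintro ⟨z, rfl⟩
    simpa using Submodule.mem_orthogonal_singleton_iff_inner_right.1 z.2

theorem sFinite_hyperplaneMeasure {n : E} (hn : ‖n‖ = 1) (p : E) :
    SFinite (hyperplaneMeasure n p) := by
  rw [hyperplaneMeasure_eq_map hn]
  infer_instance

/-- The orthogonal splitting along n is a linear isometry between spaces of equal dimension, hence
volume preserving. -/
theorem volume_eq_map_orthogonal_prod {n : E} (hn : ‖n‖ = 1) :
    (volume : Measure E) =
      ((volume : Measure (ℝ ∙ n)ᗮ).prod (volume : Measure ℝ)).map
        fun z => (z.1 : E) + z.2 • n := by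
  have h0 : n ≠ 0 := by rintro rfl; simp at hn
  let L : WithLp 2 ((ℝ ∙ n)ᗮ × ℝ) →ₗᵢ[ℝ] E :=
    { toFun := fun z => (z.fst : E) + z.snd • n
      map_add' := fun x y => by simp [add_smul]; abel
      map_smul' := fun c x => by simp [mul_smul]
      norm_map' := fun z => by
        have horth : inner ℝ (z.fst : E) (z.snd • n) = 0 := by
          rw [inner_smul_right, Submodule.mem_orthogonal_singleton_iff_inner_left.1 z.fst.2,
            mul_zero]
        have h1 := norm_add_sq_eq_norm_sq_add_norm_sq_real horth
        have h2 := WithLp.prod_norm_sq_eq_of_L2 z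
        simp only [norm_smul, hn, mul_one] at h1
        rw [← sq_eq_sq₀ (norm_nonneg _) (norm_nonneg _), h2, sq, sq, sq]
        simpa using h1 }
  have hpos : 0 < Module.finrank ℝ E := Module.finrank_pos_iff_exists_ne_zero.2 ⟨n, h0⟩
  have hr : Module.finrank ℝ (WithLp 2 ((ℝ ∙ n)ᗮ × ℝ)) = Module.finrank ℝ E := by
    rw [(WithLp.linearEquiv 2 ℝ ((ℝ ∙ n)ᗮ × ℝ)).finrank_eq, Module.finrank_prod,
      finrank_orthogonal_unit hn, Module.finrank_self]
    omega
  have h1 := (L.toLinearIsometryEquiv hr).measurePreserving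
  have h2 := h1.comp (WithLp.volume_preserving_toLp (ℝ ∙ n)ᗮ ℝ)
  exact h2.map_eq.symm

/-- Fubini's theorem for the lines in direction `a` through a hyperplane with unit normal `n`. -/
theorem volume_eq_smul_map_hyperplaneMeasure_prod {n a : E} (hn : ‖n‖ = 1)
    (ha : inner ℝ n a ≠ 0) (p : E) :
    (volume : Measure E) = ENNReal.ofReal |inner ℝ n a| •
      ((hyperplaneMeasure n p).prod (volume : Measure ℝ)).map fun z => z.1 + z.2 • a := by
  have hself : inner ℝ n n = (1 : ℝ) := by simp [hn]
  -- The shear that fixes the orthogonal complement of n and sends n to a. Its determinant ⟨n, a⟩ is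
  -- the factor between orthogonal and oblique Fubini.
  let A : E →ₗ[ℝ] E := LinearMap.transvection (innerₛₗ ℝ n) (a - n)
  have hA : ∀ x, A x = x + (inner ℝ n x : ℝ) • (a - n) := fun x => by
    simp [A, LinearMap.transvection.apply]
  have hdet : LinearMap.det A = inner ℝ n a := by
    rw [LinearMap.transvection.det]
    simp [inner_sub_right, hn]
  have hmapA := Measure.map_linearMap_addHaar_eq_smul_addHaar (volume : Measure E)
    (f := A) (by rwa [hdet])
  have hAm : Measurable A := A.continuous_of_finiteDimensional.measurable
  have hp : (volume : Measure E).map (fun x => p + x) = volume := map_add_left_eq_self _ p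
  rw [hdet] at hmapA
  have : SFinite (hyperplaneMeasure n p) := sFinite_hyperplaneMeasure hn p
  have key : ((hyperplaneMeasure n p).prod (volume : Measure ℝ)).map
      (fun z => z.1 + z.2 • a) = ENNReal.ofReal |(inner ℝ n a)⁻¹| • (volume : Measure E) := by
    calc _ = (((volume : Measure (ℝ ∙ n)ᗮ).prod (volume : Measure ℝ)).map
          (Prod.map (fun y : (ℝ ∙ n)ᗮ => p + (y : E)) id)).map
          (fun z => z.1 + z.2 • a) := by
            rw [← Measure.map_prod_map _ _ (by fun_prop) measurable_id,
              hyperplaneMeasure_eq_map hn, Measure.map_id]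
      _ = ((volume.map A).map (fun x => p + x)) := by
            rw [volume_eq_map_orthogonal_prod hn, Measure.map_map (by fun_prop) (by fun_prop),
              Measure.map_map hAm (by fun_prop), Measure.map_map (by fun_prop) (by fun_prop)]
            congr 1
            ext z
            have hz : inner ℝ n (z.1 : E) = (0 : ℝ) :=
              Submodule.mem_orthogonal_singleton_iff_inner_right.1 z.1.2
            simp only [Function.comp, Prod.map, hA, id, inner_add_right, inner_smul_right, hz,
              hself]
            simp only [mul_one, zero_add, smul_sub]
            abel
      _ = _ := by rw [hmapA, Measure.map_smul, hp]
  rw [key, smul_smul, ← ENNReal.ofReal_mul (abs_nonneg _), ← abs_mul, mul_inv_cancel₀ ha]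
  simp

theorem lintegral_eq_mul_lintegral_hyperplaneMeasure {n a : E} (hn : ‖n‖ = 1)
    (ha : inner ℝ n a ≠ 0) (p : E) {g : E → ENNReal} (hg : Measurable g) :
    ∫⁻ x, g x = ENNReal.ofReal |inner ℝ n a| *
      ∫⁻ y, (∫⁻ t : ℝ, g (y + t • a)) ∂(hyperplaneMeasure n p) := by
  have : SFinite (hyperplaneMeasure n p) := sFinite_hyperplaneMeasure hn p
  rw [volume_eq_smul_map_hyperplaneMeasure_prod hn ha p, lintegral_smul_measure,
    lintegral_map hg (by fun_prop), lintegral_prod _ (by fun_prop), smul_eq_mul]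

theorem integral_eq_mul_integral_hyperplaneMeasure {n a : E} (hn : ‖n‖ = 1)
    (ha : inner ℝ n a ≠ 0) (p : E) {g : E → ℝ} (hg : Integrable g) :
    ∫ x, g x = |inner ℝ n a| *
      ∫ y, (∫ t : ℝ, g (y + t • a)) ∂(hyperplaneMeasure n p) := by
  have : SFinite (hyperplaneMeasure n p) := sFinite_hyperplaneMeasure hn p
  have hm : AEMeasurable (fun z : E × ℝ => z.1 + z.2 • a)
    ((hyperplaneMeasure n p).prod (volume : Measure ℝ)) := by fun_prop
  have hg' : Integrable g (((hyperplaneMeasure n p).prod (volume : Measure ℝ)).map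
      fun z => z.1 + z.2 • a) := by
    rw [volume_eq_smul_map_hyperplaneMeasure_prod hn ha p,
      integrable_smul_measure (by simpa using ha) ENNReal.ofReal_ne_top] at hg
    exact hg
  have hc : Integrable (fun z : E × ℝ => g (z.1 + z.2 • a))
      ((hyperplaneMeasure n p).prod (volume : Measure ℝ)) :=
    (integrable_map_measure hg'.aestronglyMeasurable hm).1 hg'
  rw [volume_eq_smul_map_hyperplaneMeasure_prod hn ha p, integral_smul_measure,
    integral_map hm hg'.aestronglyMeasurable, integral_prod _ hc, smul_eq_mul,
    ENNReal.toReal_ofReal (abs_nonneg _)]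

end ObliqueFubini

/-! ### The divergence theorem on a simplex in the direction of an edge -/

section Simplex

variable {E : Type*} [NormedAddCommGroup E] [InnerProductSpace ℝ E]
  {ι : Type*} [Fintype ι]

/-- `n` is the outward unit normal on the face of the simplex `b` opposite to the vertex `b i`. -/
structure IsFaceNormal (b : AffineBasis ι ℝ E) (i : ι) (n : E) : Prop where
  norm_eq : ‖n‖ = 1
  inner_eq_zero : ∀ j, j ≠ i → ∀ k, k ≠ i → inner ℝ n (b k - b j) = 0
  inner_neg : ∀ j, j ≠ i → inner ℝ n (b i - b j) < 0

theorem AffineBasis.mem_convexHull_face_iff (b : AffineBasis ι ℝ E) (i : ι) (x : E) :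
    x ∈ convexHull ℝ (b '' {i}ᶜ) ↔ b.coord i x = 0 ∧ ∀ j, 0 ≤ b.coord j x := by
  classical
  constructor
  · intro hx
    refine ⟨?_, ?_⟩
    · have h : convexHull ℝ (b '' {i}ᶜ) ⊆ {x | b.coord i x = 0} := by
        refine convexHull_min ?_ ((convex_singleton (0 : ℝ)).affine_preimage (b.coord i))
        rintro _ ⟨j, hj, rfl⟩
        exact b.coord_apply_ne (Ne.symm hj)
      exact h hx
    · have h := convexHull_mono (Set.image_subset_range b {i}ᶜ) hx
      rw [b.convexHull_eq_nonneg_coord] at h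
      exact h
  · rintro ⟨h0, hpos⟩
    have hsum := b.sum_coord_apply_eq_one x
    have hx := b.linear_combination_coord_eq_self x
    rw [← Finset.add_sum_erase _ _ (Finset.mem_univ i), h0, zero_add] at hsum
    rw [← Finset.add_sum_erase _ _ (Finset.mem_univ i), h0, zero_smul, zero_add] at hx
    rw [← hx]
    exact (convex_convexHull ℝ _).sum_mem (fun j _ => hpos j) hsum fun j hj =>
      subset_convexHull ℝ _ ⟨j, by simpa using hj, rfl⟩

/-- Expand y - b j in the edges b k - b j: all of them except the one to b i lie in the face and are
orthogonal to n. -/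
theorem IsFaceNormal.inner_sub_eq {b : AffineBasis ι ℝ E} {i j : ι} {n : E}
    (h : IsFaceNormal b i n) (hj : j ≠ i) (y : E) :
    inner ℝ n (y - b j) = b.coord i y * inner ℝ n (b i - b j) := by
  classical
  have hy : y - b j = ∑ k, b.coord k y • (b k - b j) := by
    simp_rw [smul_sub]
    rw [Finset.sum_sub_distrib, b.linear_combination_coord_eq_self, ← Finset.sum_smul,
      b.sum_coord_apply_eq_one, one_smul]
  rw [hy, inner_sum, Finset.sum_eq_single i]
  · rw [inner_smul_right]
  · intro k _ hk
    rw [inner_smul_right, h.inner_eq_zero j hj k hk, mul_zero]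
  · simp

theorem IsFaceNormal.setOf_inner_eq_zero {b : AffineBasis ι ℝ E} {i j : ι} {n : E}
    (h : IsFaceNormal b i n) (hj : j ≠ i) :
    {y | inner ℝ n (y - b j) = 0} = {y | b.coord i y = 0} := by
  ext y
  simp only [Set.mem_ofPred_eq, h.inner_sub_eq hj y, mul_eq_zero, (h.inner_neg j hj).ne, or_false]

variable [FiniteDimensional ℝ E]

omit [Fintype ι] in
theorem exists_isFaceNormal [Nontrivial ι] (b : AffineBasis ι ℝ E) (i : ι) :
    ∃ n, IsFaceNormal b i n := by
  have : CompleteSpace E := FiniteDimensional.complete ℝ E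
  -- The gradient of the i-th barycentric coordinate. It is orthogonal to the face where that
  -- coordinate vanishes and points towards b i, so the outward normal is its negative, normalised.
  let g : E := (InnerProductSpace.toDual ℝ E).symm (LinearMap.toContinuousLinearMap
    (b.coord i).linear)
  have hg : ∀ x y, inner ℝ g (x - y) = b.coord i x - b.coord i y := fun x y => by
    rw [InnerProductSpace.toDual_symm_apply]
    exact (b.coord i).linearMap_vsub x y
  have hg1 : ∀ j, j ≠ i → inner ℝ g (b i - b j) = 1 := fun j hj => by
    rw [hg, b.coord_apply_eq, b.coord_apply_ne hj.symm, sub_zero]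
  obtain ⟨j, hj⟩ := exists_ne i
  have h0 : g ≠ 0 := by
    intro h
    have := hg1 j hj
    simp [h] at this
  have hpos : 0 < ‖g‖⁻¹ := inv_pos.2 (norm_pos_iff.2 h0)
  refine ⟨(-‖g‖⁻¹) • g, ?_, ?_, ?_⟩
  · rw [norm_smul, norm_neg, norm_inv, norm_norm, inv_mul_cancel₀ (norm_ne_zero_iff.2 h0)]
  · intro k hk l hl
    rw [inner_smul_left, hg, b.coord_apply_ne hk.symm, b.coord_apply_ne hl.symm]
    simp
  · intro k hk
    rw [inner_smul_left, hg1 k hk]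
    simpa using h0

variable [MeasurableSpace E] [BorelSpace E]

theorem isFiniteMeasureOnCompacts_hyperplaneMeasure {n : E} (hn : ‖n‖ = 1) (p : E) :
    IsFiniteMeasureOnCompacts (hyperplaneMeasure n p) := by
  rw [hyperplaneMeasure_eq_map hn]
  have h : Topology.IsClosedEmbedding fun y : (ℝ ∙ n)ᗮ => p + (y : E) :=
    (Homeomorph.addLeft p).isClosedEmbedding.comp
      (Submodule.isClosed_orthogonal _).isClosedEmbedding_subtypeVal
  refine ⟨fun K hK => ?_⟩
  rw [Measure.map_apply h.continuous.measurable hK.measurableSet]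
  exact (h.isCompact_preimage hK).measure_lt_top

omit [FiniteDimensional ℝ E] [MeasurableSpace E] [BorelSpace E] in
theorem isCompact_convexHull_face (b : AffineBasis ι ℝ E) (i : ι) :
    IsCompact (convexHull ℝ (b '' {i}ᶜ)) :=
  (Set.toFinite _).isCompact_convexHull ℝ

-- The face lies in the hyperplane, so its surface measure may be replaced by the hyperplane
-- measure, to which Fubini applies.
omit [FiniteDimensional ℝ E] in
theorem IsFaceNormal.restrict_face {b : AffineBasis ι ℝ E} {i j : ι} {n : E}
    (h : IsFaceNormal b i n) (hj : j ≠ i) :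
    (μHE[Module.finrank ℝ E - 1] : Measure E).restrict (convexHull ℝ (b '' {i}ᶜ)) =
      (hyperplaneMeasure n (b j)).restrict (convexHull ℝ (b '' {i}ᶜ)) := by
  rw [hyperplaneMeasure, Measure.restrict_restrict
    (isCompact_convexHull_face b i).measurableSet, h.setOf_inner_eq_zero hj,
    Set.inter_eq_left.2 fun x hx => Set.mem_ofPred_eq.mpr
      ((b.mem_convexHull_face_iff i x).1 hx).1]

theorem IsFaceNormal.integrable_face [Nontrivial ι] {b : AffineBasis ι ℝ E} {i : ι} {n : E}
    (h : IsFaceNormal b i n) {f : E → ℝ} (hf : Continuous f) :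
    IntegrableOn f (convexHull ℝ (b '' {i}ᶜ)) μHE[Module.finrank ℝ E - 1] := by
  obtain ⟨j, hj⟩ := exists_ne i
  have := isFiniteMeasureOnCompacts_hyperplaneMeasure h.norm_eq (b j)
  rw [IntegrableOn, h.restrict_face hj]
  exact hf.continuousOn.integrableOn_compact (isCompact_convexHull_face b i)

theorem IsFaceNormal.ae_coord_eq_zero {b : AffineBasis ι ℝ E} {i j : ι} {n : E}
    (h : IsFaceNormal b i n) (hj : j ≠ i) :
    ∀ᵐ y ∂(hyperplaneMeasure n (b j)), b.coord i y = 0 := by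
  rw [hyperplaneMeasure, h.setOf_inner_eq_zero hj]
  refine ae_restrict_mem (measurableSet_eq_fun ?_ measurable_const)
  exact (continuous_barycentric_coord b i).measurable

omit [Fintype ι] [FiniteDimensional ℝ E] [MeasurableSpace E] [BorelSpace E] in
theorem AffineBasis.coord_add_smul_sub [DecidableEq ι] (b : AffineBasis ι ℝ E) (i j k : ι)
    (y : E) (t : ℝ) :
    b.coord i (y + t • (b k - b j)) =
      b.coord i y + t * ((if i = k then 1 else 0) - if i = j then 1 else 0) := by
  have h := (b.coord i).map_vadd y (t • (b k - b j))
  rw [vadd_eq_add, vadd_eq_add, add_comm] at h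
  have h2 : (b.coord i).linear (b k - b j) = b.coord i (b k) - b.coord i (b j) :=
    (b.coord i).linearMap_vsub (b k) (b j)
  rw [h, map_smul, h2, b.coord_apply, b.coord_apply, smul_eq_mul, add_comm]

/-- The faces of a simplex opposite to the vertices `b j` and `b k` are projected onto each other
along the edge from `b j` to `b k`; the surface measures are related by the normals. -/
theorem lintegral_face_eq_lintegral_face {b : AffineBasis ι ℝ E} {j k : ι} (hjk : j ≠ k)
    {n m : E} (hn : IsFaceNormal b j n) (hm : IsFaceNormal b k m)
    {G : E → ENNReal} (hG : Measurable G) :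
    ENNReal.ofReal |inner ℝ n (b k - b j)| *
        ∫⁻ y in convexHull ℝ (b '' {j}ᶜ), G y ∂μHE[Module.finrank ℝ E - 1] =
      ENNReal.ofReal |inner ℝ m (b k - b j)| *
        ∫⁻ y in convexHull ℝ (b '' {k}ᶜ), G (y + b.coord j y • (b k - b j))
          ∂μHE[Module.finrank ℝ E - 1] := by
  classical
  set a := b k - b j with ha
  set Fj := convexHull ℝ (b '' {j}ᶜ) with hFj
  set Fk := convexHull ℝ (b '' {k}ᶜ) with hFk
  have hjm : MeasurableSet Fj := (isCompact_convexHull_face b j).measurableSet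
  have hkm : MeasurableSet Fk := (isCompact_convexHull_face b k).measurableSet
  have hna : inner ℝ n a ≠ 0 := by
    rw [ha, ← neg_sub (b j), inner_neg_right]
    exact neg_ne_zero.2 (hn.inner_neg k hjk.symm).ne
  have hma : inner ℝ m a ≠ 0 := (hm.inner_neg j hjk).ne
  have hcm : Measurable (b.coord j) := (continuous_barycentric_coord b j).measurable
  have hI : Measurable ((Set.Icc (0 : ℝ) 1).indicator (1 : ℝ → ENNReal)) :=
    measurable_one.indicator measurableSet_Icc
  have hπ : Measurable fun x => x + b.coord j x • a := by fun_prop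
  have hcoord : ∀ y (t : ℝ), b.coord j (y + t • a) = b.coord j y - t := fun y t => by
    rw [ha, b.coord_add_smul_sub, if_neg hjk, if_pos rfl]; ring
  -- The first factor is constant along lines in direction a, and the second has integral 1 on each
  -- such line. Fubini from either hyperplane therefore computes the same volume integral, as a
  -- surface integral over either face.
  let g : E → ENNReal := fun x => Fj.indicator G (x + b.coord j x • a) *
    (Set.Icc (0 : ℝ) 1).indicator 1 (b.coord j x)
  have hg : Measurable g := ((hG.indicator hjm).comp hπ).mul (hI.comp hcm)
  have hgt : ∀ y, ∫⁻ t : ℝ, g (y + t • a) = Fj.indicator G (y + b.coord j y • a) := by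
    intro y
    have h1 : ∀ t : ℝ, y + t • a + (b.coord j y - t) • a = y + b.coord j y • a := fun t => by
      rw [sub_smul]; abel
    simp only [g, hcoord, h1]
    rw [lintegral_const_mul _ (by fun_prop),
      lintegral_sub_left_eq_self (μ := volume)
        (f := (Set.Icc (0 : ℝ) 1).indicator (1 : ℝ → ENNReal)) (b.coord j y),
      lintegral_indicator_one measurableSet_Icc]
    simp
  have e1 := lintegral_eq_mul_lintegral_hyperplaneMeasure hn.norm_eq hna (b k) hg
  have e2 := lintegral_eq_mul_lintegral_hyperplaneMeasure hm.norm_eq hma (b j) hg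
  simp only [hgt] at e1 e2
  rw [hn.restrict_face hjk.symm, hm.restrict_face hjk, ← lintegral_indicator hjm,
    ← lintegral_indicator hkm]
  have f1 : ∫⁻ y, Fj.indicator G (y + b.coord j y • a) ∂(hyperplaneMeasure n (b k)) =
      ∫⁻ y, Fj.indicator G y ∂(hyperplaneMeasure n (b k)) := by
    refine lintegral_congr_ae ?_
    filter_upwards [hn.ae_coord_eq_zero hjk.symm] with y hy
    rw [hy, zero_smul, add_zero]
  have f2 : ∫⁻ y, Fj.indicator G (y + b.coord j y • a) ∂(hyperplaneMeasure m (b j)) =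
      ∫⁻ y, Fk.indicator (fun y => G (y + b.coord j y • a)) y ∂(hyperplaneMeasure m (b j)) := by
    refine lintegral_congr_ae ?_
    filter_upwards [hm.ae_coord_eq_zero hjk] with y hy
    -- Moving along a only trades the j-th coordinate for the k-th; here y has k-th coordinate 0 and
    -- its image has j-th coordinate 0.
    have hiff : y + b.coord j y • a ∈ Fj ↔ y ∈ Fk := by
      rw [hFj, hFk, b.mem_convexHull_face_iff, b.mem_convexHull_face_iff]
      simp only [ha, b.coord_add_smul_sub]
      constructor
      · rintro ⟨-, h⟩
        refine ⟨hy, fun i => ?_⟩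
        have hi := h i
        have hk := h k
        by_cases h1 : i = k
        · subst h1; rw [hy]
        · by_cases h2 : i = j
          · subst h2
            simpa [hy, hjk.symm] using hk
          · simpa [h1, h2] using hi
      · rintro ⟨-, h⟩
        refine ⟨by simp [hjk], fun i => ?_⟩
        have hi := h i
        by_cases h1 : i = k
        · subst h1; simpa [hy, hjk.symm] using h j
        · by_cases h2 : i = j
          · subst h2; simp [hjk]
          · simpa [h1, h2] using hi
    by_cases hyk : y ∈ Fk
    · rw [Set.indicator_of_mem hyk, Set.indicator_of_mem (hiff.2 hyk)]
    · rw [Set.indicator_of_notMem hyk, Set.indicator_of_notMem (mt hiff.1 hyk)]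
  rw [← f1, ← f2, ← e1, ← e2]

theorem integral_face_eq_integral_face {b : AffineBasis ι ℝ E} {j k : ι} (hjk : j ≠ k)
    {n m : E} (hn : IsFaceNormal b j n) (hm : IsFaceNormal b k m)
    {f : E → ℝ} (hf : Continuous f) :
    |inner ℝ n (b k - b j)| *
        ∫ y in convexHull ℝ (b '' {j}ᶜ), f y ∂μHE[Module.finrank ℝ E - 1] =
      |inner ℝ m (b k - b j)| *
        ∫ y in convexHull ℝ (b '' {k}ᶜ), f (y + b.coord j y • (b k - b j))
          ∂μHE[Module.finrank ℝ E - 1] := by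
  have hcm : Continuous (b.coord j) := continuous_barycentric_coord b j
  have hπ : Continuous fun x => x + b.coord j x • (b k - b j) := by fun_prop
  have hmeas : ENNReal.ofReal |inner ℝ n (b k - b j)| •
      (μHE[Module.finrank ℝ E - 1] : Measure E).restrict (convexHull ℝ (b '' {j}ᶜ)) =
      ENNReal.ofReal |inner ℝ m (b k - b j)| •
      ((μHE[Module.finrank ℝ E - 1] : Measure E).restrict (convexHull ℝ (b '' {k}ᶜ))).map
        fun x => x + b.coord j x • (b k - b j) := by
    refine Measure.ext_of_lintegral _ fun G hG => ?_
    rw [lintegral_smul_measure, lintegral_smul_measure, lintegral_map hG hπ.measurable]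
    exact lintegral_face_eq_lintegral_face hjk hn hm hG
  have h := congrArg (fun ν => ∫ y, f y ∂ν) hmeas
  simp only [integral_smul_measure, ENNReal.toReal_ofReal (abs_nonneg _), smul_eq_mul] at h
  rw [h, integral_map hπ.measurable.aemeasurable hf.aestronglyMeasurable]

/-- The divergence theorem on a simplex, in the direction of an edge. -/
theorem integral_simplex_edge_deriv {b : AffineBasis ι ℝ E} {j k : ι} (hjk : j ≠ k)
    {n m : E} (hn : IsFaceNormal b j n) (hm : IsFaceNormal b k m)
    {f f' : E → ℝ} (hf : Continuous f) (hf' : Continuous f')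
    (hderiv : ∀ x (t : ℝ), HasDerivAt (fun s : ℝ => f (x + s • (b k - b j)))
      (f' (x + t • (b k - b j))) t) :
    ∫ x in convexHull ℝ (Set.range b), f' x =
      inner ℝ n (b k - b j) *
        (∫ y in convexHull ℝ (b '' {j}ᶜ), f y ∂μHE[Module.finrank ℝ E - 1]) +
      inner ℝ m (b k - b j) *
        (∫ y in convexHull ℝ (b '' {k}ᶜ), f y ∂μHE[Module.finrank ℝ E - 1]) := by
  classical
  have : Nontrivial ι := ⟨j, k, hjk⟩
  have hface := integral_face_eq_integral_face hjk hn hm hf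
  set a := b k - b j with ha
  set S := convexHull ℝ (Set.range b) with hS
  have hScomp : IsCompact S := (Set.finite_range b).isCompact_convexHull ℝ
  set Fk := convexHull ℝ (b '' {k}ᶜ) with hFk
  have hkm : MeasurableSet Fk := (isCompact_convexHull_face b k).measurableSet
  have hna : 0 < inner ℝ n a := by
    rw [ha, ← neg_sub (b j), inner_neg_right]
    exact neg_pos.2 (hn.inner_neg k hjk.symm)
  have hma : inner ℝ m a < 0 := hm.inner_neg j hjk
  have hint : Integrable (S.indicator f') :=
    (integrable_indicator_iff hScomp.measurableSet).2
      (hf'.continuousOn.integrableOn_compact hScomp)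
  have e := integral_eq_mul_integral_hyperplaneMeasure hm.norm_eq hma.ne (b j) hint
  rw [integral_indicator hScomp.measurableSet] at e
  have hcm : Continuous (b.coord j) := continuous_barycentric_coord b j
  -- A line in direction a enters the simplex at y in the face opposite b k and leaves it when the
  -- j-th coordinate, decreasing at unit rate, reaches 0.
  have hline : ∀ y, b.coord k y = 0 → ∀ t : ℝ,
      y + t • a ∈ S ↔ y ∈ Fk ∧ t ∈ Set.Icc 0 (b.coord j y) := by
    intro y hy t
    rw [hS, hFk, b.convexHull_eq_nonneg_coord, b.mem_convexHull_face_iff]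
    simp only [ha, Set.mem_ofPred_eq, b.coord_add_smul_sub, Set.mem_Icc]
    constructor
    · intro h
      have h1 := h k
      have h2 := h j
      simp only [if_true, hjk, hjk.symm, if_false, hy] at h1 h2
      refine ⟨⟨hy, fun i => ?_⟩, by linarith, by linarith⟩
      have hi := h i
      by_cases h3 : i = k
      · subst h3; exact hy.ge
      · by_cases h4 : i = j
        · subst h4; linarith
        · simpa [h3, h4] using hi
    · rintro ⟨⟨-, h⟩, h1, h2⟩ i
      have hi := h i
      by_cases h3 : i = k
      · subst h3; simpa [hjk.symm, hy] using h1
      · by_cases h4 : i = j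
        · subst h4; simpa [h3] using h2
        · simpa [h3, h4] using hi
  have hinner : ∫ y, (∫ t : ℝ, S.indicator f' (y + t • a)) ∂(hyperplaneMeasure m (b j)) =
      ∫ y, Fk.indicator (fun y => f (y + b.coord j y • a) - f y) y
        ∂(hyperplaneMeasure m (b j)) := by
    refine integral_congr_ae ?_
    filter_upwards [hm.ae_coord_eq_zero hjk] with y hy
    by_cases hyk : y ∈ Fk
    · have h0 : 0 ≤ b.coord j y := ((b.mem_convexHull_face_iff k y).1 hyk).2 j
      have h1 : ∀ t : ℝ, S.indicator f' (y + t • a) =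
          (Set.Icc 0 (b.coord j y)).indicator (fun t => f' (y + t • a)) t := fun t => by
        by_cases ht : t ∈ Set.Icc 0 (b.coord j y)
        · rw [Set.indicator_of_mem ht, Set.indicator_of_mem ((hline y hy t).2 ⟨hyk, ht⟩)]
        · rw [Set.indicator_of_notMem ht,
            Set.indicator_of_notMem (mt (fun h => ((hline y hy t).1 h).2) ht)]
      simp only [h1]
      rw [integral_indicator measurableSet_Icc, integral_Icc_eq_integral_Ioc,
        ← intervalIntegral.integral_of_le h0, Set.indicator_of_mem hyk,
        intervalIntegral.integral_eq_sub_of_hasDerivAt (fun t _ => hderiv y t)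
          (Continuous.intervalIntegrable (by fun_prop) _ _)]
      simp
    · have h1 : ∀ t : ℝ, S.indicator f' (y + t • a) = 0 := fun t =>
        Set.indicator_of_notMem (mt (fun h => ((hline y hy t).1 h).1) hyk) _
      simp only [h1, integral_zero, Set.indicator_of_notMem hyk]
  -- The exit values are integrated over the entry face; `hface` moves them to the exit face. The
  -- absolute values resolve to the two signs of the outward flux.
  rw [e, hinner, integral_indicator hkm, ← hm.restrict_face hjk,
    integral_sub (hm.integrable_face (by fun_prop)) (hm.integrable_face hf), mul_sub, ← hface,
    abs_of_pos hna, abs_of_neg hma]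
  ring

end Simplex

/-! ### Polynomials on a simplex: arbitrary directions -/

namespace NSK

/-- The value of a polynomial at a point of Euclidean space. -/
noncomputable def polyEval {d : ℕ} (P : MvPolynomial (Fin d) ℝ) (x : Pt d) : ℝ :=
  MvPolynomial.eval (fun i => x i) P

theorem continuous_polyEval {d : ℕ} (P : MvPolynomial (Fin d) ℝ) : Continuous (polyEval P) :=
  (MvPolynomial.continuous_eval P).comp (by fun_prop)

theorem hasDerivAt_polyEval {d : ℕ} (P : MvPolynomial (Fin d) ℝ) (x a : Pt d) (t : ℝ) :
    HasDerivAt (fun s : ℝ => polyEval P (x + s • a))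
      (∑ i, a i * polyEval (MvPolynomial.pderiv i P) (x + t • a)) t := by
  simp only [polyEval]
  induction P using MvPolynomial.induction_on with
  | C c => simpa using hasDerivAt_const t c
  | add p q hp hq =>
    simp only [map_add, mul_add, Finset.sum_add_distrib]
    exact hp.add hq
  | mul_X p j hp =>
    have hX : HasDerivAt (fun s : ℝ => (x + s • a) j) (a j) t := by
      simpa using ((hasDerivAt_id t).mul_const (a j)).const_add (x j)
    have h := hp.mul hX
    simp only [map_mul, MvPolynomial.eval_X]
    refine h.congr_deriv ?_
    simp only [Derivation.leibniz, MvPolynomial.pderiv_X, smul_eq_mul, map_add, map_mul,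
      MvPolynomial.eval_X, mul_add, Finset.sum_add_distrib, Finset.sum_mul]
    rw [add_comm]
    congr 1
    · rw [Finset.sum_eq_single j]
      · simp [mul_comm]
      · intro i _ hi
        simp [hi.symm]
      · simp
    · exact Finset.sum_congr rfl fun i _ => by ring

/-- The divergence theorem for a polynomial on a simplex, in an arbitrary direction. -/
theorem integral_simplex_dir_deriv {d : ℕ} {ι : Type*} [Fintype ι] [Nontrivial ι]
    (b : AffineBasis ι ℝ (Pt d)) {n : ι → Pt d} (hn : ∀ i, IsFaceNormal b i (n i))
    (P : MvPolynomial (Fin d) ℝ) (a : Pt d) :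
    ∑ i, a i * ∫ x in convexHull ℝ (Set.range b), polyEval (MvPolynomial.pderiv i P) x =
      ∑ k, inner ℝ (n k) a *
        ∫ x in convexHull ℝ (b '' {k}ᶜ), polyEval P x ∂μHE[d - 1] := by
  classical
  obtain ⟨j, -, -⟩ := exists_pair_ne ι
  have hcomp : IsCompact (convexHull ℝ (Set.range b)) :=
    (Set.finite_range b).isCompact_convexHull ℝ
  let c : Fin d → ℝ := fun i =>
    ∫ x in convexHull ℝ (Set.range b), polyEval (MvPolynomial.pderiv i P) x
  let s : ι → ℝ := fun k => ∫ x in convexHull ℝ (b '' {k}ᶜ), polyEval P x ∂μHE[d - 1]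
  let L₁ : Pt d →ₗ[ℝ] ℝ :=
    { toFun := fun a => ∑ i, a i * c i
      map_add' := fun x y => by simp [add_mul, Finset.sum_add_distrib]
      map_smul' := fun r x => by simp [mul_assoc, Finset.mul_sum] }
  let L₂ : Pt d →ₗ[ℝ] ℝ :=
    { toFun := fun a => ∑ k, inner ℝ (n k) a * s k
      map_add' := fun x y => by simp [add_mul, inner_add_right, Finset.sum_add_distrib]
      map_smul' := fun r x => by simp [mul_assoc, inner_smul_right, Finset.mul_sum] }
  suffices h : L₁ = L₂ from LinearMap.congr_fun h a
  -- Both sides are linear in a, so the edges issuing from b j suffice.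
  refine (b.basisOf j).ext fun ⟨k, hk⟩ => ?_
  rw [b.basisOf_apply, vsub_eq_sub]
  change ∑ i, (b k - b j) i * c i = ∑ i, inner ℝ (n i) (b k - b j) * s i
  have h := integral_simplex_edge_deriv hk.symm (hn j) (hn k) (continuous_polyEval P)
    (f' := fun x => ∑ i, (b k - b j) i * polyEval (MvPolynomial.pderiv i P) x)
    (continuous_finsetSum _ fun i _ => continuous_const.mul (continuous_polyEval _))
    (fun x t => hasDerivAt_polyEval P x _ t)
  have hint : ∀ i ∈ (Finset.univ : Finset (Fin d)), IntegrableOn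
      (fun x => (b k - b j) i * polyEval (MvPolynomial.pderiv i P) x)
      (convexHull ℝ (Set.range b)) := fun i _ =>
    (continuous_const.mul (continuous_polyEval _)).continuousOn.integrableOn_compact hcomp
  rw [integral_finsetSum _ hint] at h
  simp only [integral_const_mul, finrank_euclideanSpace_fin] at h
  change ∑ i, (b k - b j) i * c i = _ * s j + _ * s k at h
  rw [h, ← Finset.sum_pair (f := fun i => inner ℝ (n i) (b k - b j) * s i) hk.symm]
  -- The edge from b j to b k is parallel to every other face, whose flux vanishes.
  refine Finset.sum_subset (Finset.subset_univ _) fun i _ hi => ?_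
  simp only [Finset.mem_insert, Finset.mem_singleton, not_or] at hi
  rw [(hn i).inner_eq_zero j (Ne.symm hi.1) k (Ne.symm hi.2), zero_mul]

/-! ### The divergence theorem in terms of vertex sets and facets -/

section Element

variable {d : ℕ} {K : Finset (Pt d)}

/-- The affine basis formed by the vertices of a nondegenerate simplex. -/
noncomputable def vertexBasis (hc : K.card = d + 1) (hi : AffineIndependent ℝ ((↑) : K → Pt d)) :
    AffineBasis K ℝ (Pt d) :=
  ⟨(↑), hi, hi.affineSpan_eq_top_iff_card_eq_finrank_add_one.2 (by simp [hc])⟩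

theorem range_vertexBasis (hc : K.card = d + 1) (hi : AffineIndependent ℝ ((↑) : K → Pt d)) :
    Set.range (vertexBasis hc hi) = (K : Set (Pt d)) :=
  Subtype.range_coe

theorem image_vertexBasis [DecidableEq (Pt d)] (hc : K.card = d + 1)
    (hi : AffineIndependent ℝ ((↑) : K → Pt d)) (k : K) :
    vertexBasis hc hi '' {k}ᶜ = (K.erase k : Set (Pt d)) := by
  ext x
  simp only [Set.mem_image, Set.mem_compl_iff, Set.mem_singleton_iff, Finset.mem_coe,
    Finset.mem_erase]
  constructor
  · rintro ⟨y, hy, rfl⟩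
    exact ⟨fun h => hy (Subtype.ext h), y.2⟩
  · rintro ⟨h1, h2⟩
    exact ⟨⟨x, h2⟩, fun h => h1 (congrArg Subtype.val h), rfl⟩

theorem isFaceNormal_iff_isOutwardNormal [DecidableEq (Pt d)] (hc : K.card = d + 1)
    (hi : AffineIndependent ℝ ((↑) : K → Pt d)) (k : K) (n : Pt d) :
    IsFaceNormal (vertexBasis hc hi) k n ↔ IsOutwardNormal K (K.erase k) n := by
  constructor
  · rintro ⟨h1, h2, h3⟩
    refine ⟨h1, fun x hx y hy => ?_, fun x hx y hy hye => ?_⟩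
    · rw [Finset.mem_erase] at hx hy
      exact h2 ⟨x, hx.2⟩ (fun h => hx.1 (congrArg Subtype.val h)) ⟨y, hy.2⟩
        (fun h => hy.1 (congrArg Subtype.val h))
    · rw [Finset.mem_erase] at hx
      obtain rfl : y = k := by
        by_contra h
        exact hye (Finset.mem_erase.2 ⟨h, hy⟩)
      exact h3 ⟨x, hx.2⟩ (fun h => hx.1 (congrArg Subtype.val h))
  · rintro ⟨h1, h2, h3⟩
    have hmem : ∀ j : K, j ≠ k → (j : Pt d) ∈ K.erase k := fun j hj =>
      Finset.mem_erase.2 ⟨fun h => hj (Subtype.ext h), j.2⟩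
    exact ⟨h1, fun j hj l hl => h2 j (hmem j hj) l (hmem l hl),
      fun j hj => h3 j (hmem j hj) k k.2 (by simp)⟩

theorem nontrivial_vertices (hd : 1 ≤ d) (hc : K.card = d + 1) : Nontrivial K :=
  Fintype.one_lt_card_iff_nontrivial.1 (by rw [Fintype.card_coe]; omega)

/-- The choice in `outwardNormal` is meaningful only because a normal exists; constructing one needs
a second vertex, hence 1 ≤ d. -/
theorem isFaceNormal_outwardNormal [DecidableEq (Pt d)] (hd : 1 ≤ d) (hc : K.card = d + 1)
    (hi : AffineIndependent ℝ ((↑) : K → Pt d)) (k : K) :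
    IsFaceNormal (vertexBasis hc hi) k (outwardNormal K (K.erase k)) := by
  have := nontrivial_vertices hd hc
  obtain ⟨n, hn⟩ := exists_isFaceNormal (vertexBasis hc hi) k
  rw [isFaceNormal_iff_isOutwardNormal] at hn ⊢
  exact Classical.epsilon_spec ⟨n, hn⟩

theorem sum_powersetCard_eq_sum_erase [DecidableEq (Pt d)] (hc : K.card = d + 1)
    (g : Finset (Pt d) → ℝ) :
    ∑ e ∈ K.powersetCard d, g e = ∑ k : K, g (K.erase k) := by
  symm
  refine Finset.sum_bij (fun k _ => K.erase (k : Pt d)) ?_ ?_ ?_ fun _ _ => rfl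
  · intro k _
    rw [Finset.mem_powersetCard]
    exact ⟨Finset.erase_subset _ _, by rw [Finset.card_erase_of_mem k.2, hc]; rfl⟩
  · intro k _ l _ h
    exact Subtype.ext ((Finset.erase_injOn K) k.2 l.2 h)
  · intro e he
    obtain ⟨h1, h2⟩ := Finset.mem_powersetCard.1 he
    obtain ⟨k, hk, hke⟩ := Finset.exists_eq_insert_iff.2 ⟨h1, by rw [h2, hc]⟩
    refine ⟨⟨k, hke ▸ Finset.mem_insert_self k e⟩, Finset.mem_univ _, ?_⟩
    simp [← hke, Finset.erase_insert hk]

theorem facet_integrable (hd : 1 ≤ d) (hc : K.card = d + 1)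
    (hi : AffineIndependent ℝ ((↑) : K → Pt d)) {e : Finset (Pt d)} (he : e ∈ K.powersetCard d)
    {f : Pt d → ℝ} (hf : Continuous f) : Integrable f (facetMeasure e) := by
  classical
  have := nontrivial_vertices hd hc
  obtain ⟨h1, h2⟩ := Finset.mem_powersetCard.1 he
  obtain ⟨k, hk, hke⟩ := Finset.exists_eq_insert_iff.2 ⟨h1, by rw [h2, hc]⟩
  have hkK : k ∈ K := hke ▸ Finset.mem_insert_self k e
  obtain rfl : e = K.erase k := by simp [← hke, Finset.erase_insert hk]
  have h := (isFaceNormal_outwardNormal hd hc hi ⟨k, hkK⟩).integrable_face hf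
  rwa [image_vertexBasis, finrank_euclideanSpace_fin] at h

/-- The divergence theorem for a polynomial vector field on a simplex. -/
theorem integral_div_simplex (hd : 1 ≤ d) (hc : K.card = d + 1)
    (hi : AffineIndependent ℝ ((↑) : K → Pt d)) (w : Fin d → MvPolynomial (Fin d) ℝ) :
    ∫ x in interior (convexHull ℝ (K : Set (Pt d))),
        polyEval (∑ i, MvPolynomial.pderiv i (w i)) x =
      ∑ e ∈ K.powersetCard d,
        ∫ x, ∑ i, polyEval (w i) x * outwardNormal K e i ∂(facetMeasure e) := by
  classical
  have := nontrivial_vertices hd hc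
  have hcomp : IsCompact (convexHull ℝ (K : Set (Pt d))) :=
    K.finite_toSet.isCompact_convexHull ℝ
  -- The frontier of a convex set is null, so open and closed simplex have the same integrals.
  have hae : (interior (convexHull ℝ (K : Set (Pt d))) : Set (Pt d)) =ᵐ[volume]
      convexHull ℝ (K : Set (Pt d)) :=
    interior_ae_eq_of_null_frontier ((convex_convexHull ℝ _).addHaar_frontier volume)
  rw [setIntegral_congr_set hae]
  simp only [polyEval, map_sum]
  change ∫ x in convexHull ℝ (K : Set (Pt d)),
    ∑ i, polyEval (MvPolynomial.pderiv i (w i)) x = ∑ e ∈ K.powersetCard d,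
        ∫ x, ∑ i, polyEval (w i) x * outwardNormal K e i ∂(facetMeasure e)
  rw [integral_finsetSum _ fun i _ =>
    (continuous_polyEval _).continuousOn.integrableOn_compact hcomp]
  have h2 : ∀ e ∈ K.powersetCard d,
      ∫ x, ∑ i, polyEval (w i) x * outwardNormal K e i ∂(facetMeasure e) =
      ∑ i, outwardNormal K e i * ∫ x, polyEval (w i) x ∂(facetMeasure e) := fun e he => by
    have hint : ∀ i ∈ (Finset.univ : Finset (Fin d)), Integrable
        (fun x => polyEval (w i) x * outwardNormal K e i) (facetMeasure e) := fun i _ =>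
      facet_integrable hd hc hi he ((continuous_polyEval _).mul continuous_const)
    rw [integral_finsetSum _ hint]
    exact Finset.sum_congr rfl fun i _ => by rw [integral_mul_const, mul_comm]
  rw [Finset.sum_congr rfl h2, Finset.sum_comm]
  refine Finset.sum_congr rfl fun i _ => ?_
  rw [sum_powersetCard_eq_sum_erase hc fun e =>
    outwardNormal K e i * ∫ x, polyEval (w i) x ∂(facetMeasure e)]
  -- The i-th component of the field is differentiated in the i-th coordinate direction.
  have h := integral_simplex_dir_deriv (vertexBasis hc hi)
    (isFaceNormal_outwardNormal hd hc hi) (w i) (EuclideanSpace.single i 1)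
  simp only [range_vertexBasis, image_vertexBasis, EuclideanSpace.inner_single_right,
    PiLp.single_apply, ite_mul, one_mul, zero_mul, Finset.sum_ite_eq', Finset.mem_univ, if_true,
    conj_trivial] at h
  exact h

end Element

/-! ### The divergence theorem for broken polynomials; calculus of values and integrals -/

namespace Triangulation

variable {d : ℕ} {Ω : Set (Pt d)} {T : Triangulation Ω}

theorem continuous_val (u : T.BrokenPoly) (K : T.elements) : Continuous (val u K) :=
  continuous_polyEval (u K)

theorem mem_facets {e : Finset (Pt d)} :
    e ∈ T.facets ↔ ∃ K ∈ T.elements, e ∈ K.powersetCard d := by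
  simp [facets]

/-- Gives L² ⊂ L¹ on every facet, which makes `intE` additive. -/
theorem isFiniteMeasure_facetMeasure (hd : 1 ≤ d) {e : Finset (Pt d)} (he : e ∈ T.facets) :
    IsFiniteMeasure (facetMeasure e) := by
  obtain ⟨K, hK, heK⟩ := mem_facets.1 he
  have h := facet_integrable hd (T.card_eq K hK) (T.affineIndependent K hK) heK
    (continuous_const (y := (1 : ℝ)))
  rcases integrable_const_iff.1 h with h | h
  · exact absurd h one_ne_zero
  · exact h

theorem interfaces_subset_facets : T.interfaces ⊆ T.facets := by
  classical
  exact Finset.filter_subset _ _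

/-- The divergence theorem for piecewise polynomial fields without normal flux through `∂Ω`. -/
theorem intΩ_div_eq_intJump (hd : 1 ≤ d) (w : Fin d → T.BrokenPoly)
    (hw : ∀ K : T.elements, ∀ e ∈ T.boundaryFacets, e ⊆ (K : Finset (Pt d)) →
      ∀ x ∈ convexHull ℝ (e : Set (Pt d)),
        ∑ i, val (w i) K x * outwardNormal (K : Finset (Pt d)) e i = 0) :
    T.intΩ (val (div w)) = intJump w := by
  classical
  let S : T.elements → Finset (Pt d) → ℝ := fun K e =>
    ∫ x, ∑ i, val (w i) K x * outwardNormal (K : Finset (Pt d)) e i ∂(facetMeasure e)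
  have hL : T.intΩ (val (div w)) = ∑ K : T.elements, ∑ e ∈ (K : Finset (Pt d)).powersetCard d,
      S K e := by
    refine Finset.sum_congr rfl fun K _ => ?_
    have h := integral_div_simplex hd (T.card_eq K K.2) (T.affineIndependent K K.2)
      fun i => w i K
    have hdiv : val (div w) K = polyEval (∑ i, MvPolynomial.pderiv i (w i K)) := by
      funext x
      simp [div, dx, val, polyEval, Finset.sum_apply]
    rw [hdiv]
    exact h
  have hcard : ∀ e ∈ T.facets, e.card = d := fun e he => by
    obtain ⟨K, -, h⟩ := mem_facets.1 he
    exact (Finset.mem_powersetCard.1 h).2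
  have hcont : ∀ (K : T.elements) (e : Finset (Pt d)), Continuous fun x =>
      ∑ i, val (w i) K x * outwardNormal (K : Finset (Pt d)) e i := fun K e =>
    continuous_finsetSum _ fun i _ => (continuous_val _ _).mul continuous_const
  have hR : intJump w = ∑ e ∈ T.interfaces, ∑ K : T.elements,
      if e ⊆ (K : Finset (Pt d)) then S K e else 0 := by
    refine Finset.sum_congr rfl fun e he => ?_
    have hef := interfaces_subset_facets he
    simp only [jump]
    rw [integral_finsetSum]
    · rw [Finset.sum_filter]
    · intro K hK
      have hsub : e ⊆ (K : Finset (Pt d)) := by simpa using hK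
      exact facet_integrable hd (T.card_eq K K.2) (T.affineIndependent K K.2)
        (Finset.mem_powersetCard.2 ⟨hsub, hcard e hef⟩) (hcont K e)
  -- Both sides become sums over pairs of an element and one of its facets. They differ by the
  -- boundary facets only, where the normal trace vanishes.
  rw [hL, hR, Finset.sum_comm]
  refine Finset.sum_congr rfl fun K _ => ?_
  rw [← Finset.sum_filter]
  symm
  refine Finset.sum_subset ?_ ?_
  · intro e he
    obtain ⟨h1, h2⟩ := Finset.mem_filter.1 he
    exact Finset.mem_powersetCard.2 ⟨h2, hcard e (interfaces_subset_facets h1)⟩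
  · intro e he hne
    have hsub := (Finset.mem_powersetCard.1 he).1
    have hf : e ∈ T.facets := mem_facets.2 ⟨K, K.2, he⟩
    have hb : e ∈ T.boundaryFacets := by
      refine Finset.mem_filter.2 ⟨hf, ?_⟩
      by_contra h
      exact hne (Finset.mem_filter.2 ⟨Finset.mem_filter.2 ⟨hf, h⟩, hsub⟩)
    exact setIntegral_eq_zero_of_forall_eq_zero fun x hx => hw K e hb hsub x hx

variable {p : ℕ}

section Values

variable (u w : T.BrokenPoly) (K : T.elements) (x : Pt d)

theorem val_add : val (u + w) K x = val u K x + val w K x := by simp [val]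

theorem val_sub : val (u - w) K x = val u K x - val w K x := by simp [val]

theorem val_mul : val (u * w) K x = val u K x * val w K x := by simp [val]

theorem val_smul (c : ℝ) : val (c • u) K x = c * val u K x := by simp [val]

theorem val_sum {ι : Type*} (s : Finset ι) (f : ι → T.BrokenPoly) :
    val (∑ i ∈ s, f i) K x = ∑ i ∈ s, val (f i) K x := by simp [val, Finset.sum_apply]

theorem dx_sub (i : Fin d) : dx i (u - w) = dx i u - dx i w := by
  funext K; simp [dx]

theorem dx_mul (i : Fin d) : dx i (u * w) = u * dx i w + w * dx i u := by
  funext K; simp [dx, Derivation.leibniz]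

theorem dx_sum {ι : Type*} (i : Fin d) (s : Finset ι) (f : ι → T.BrokenPoly) :
    dx i (∑ j ∈ s, f j) = ∑ j ∈ s, dx i (f j) := by
  funext K; simp [dx, Finset.sum_apply]

end Values

section Integrals

attribute [fun_prop] continuous_val

theorem integrableOn_interior_element (K : T.elements) {f : Pt d → ℝ} (hf : Continuous f) :
    IntegrableOn f (interior (convexHull ℝ ((K : Finset (Pt d)) : Set (Pt d)))) :=
  (hf.continuousOn.integrableOn_compact
    ((K : Finset (Pt d)).finite_toSet.isCompact_convexHull ℝ)).mono_set interior_subset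

theorem intΩ_add {f g : T.elements → Pt d → ℝ} (hf : ∀ K, Continuous (f K))
    (hg : ∀ K, Continuous (g K)) :
    T.intΩ (fun K x => f K x + g K x) = T.intΩ f + T.intΩ g := by
  simp only [intΩ]
  rw [← Finset.sum_add_distrib]
  exact Finset.sum_congr rfl fun K _ => integral_add (integrableOn_interior_element K (hf K))
    (integrableOn_interior_element K (hg K))

theorem intΩ_const_mul (c : ℝ) (f : T.elements → Pt d → ℝ) :
    T.intΩ (fun K x => c * f K x) = c * T.intΩ f := by
  simp only [intΩ, Finset.mul_sum, integral_const_mul]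

theorem intΩ_sub {f g : T.elements → Pt d → ℝ} (hf : ∀ K, Continuous (f K))
    (hg : ∀ K, Continuous (g K)) :
    T.intΩ (fun K x => f K x - g K x) = T.intΩ f - T.intΩ g := by
  have h := intΩ_add hf fun K => (hg K).const_mul (-1)
  rw [intΩ_const_mul] at h
  simpa [sub_eq_add_neg] using h

theorem integrable_skeletonL2 (hd : 1 ≤ d) (F : T.SkeletonL2) (e : T.interfaces) :
    Integrable (F e) (facetMeasure (e : Finset (Pt d))) := by
  have := isFiniteMeasure_facetMeasure hd (interfaces_subset_facets e.2)
  exact (Lp.memLp (F e)).integrable one_le_two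

theorem intE_add (hd : 1 ≤ d) (F G : T.SkeletonL2) : intE (F + G) = intE F + intE G := by
  simp only [intE]
  rw [← Finset.sum_add_distrib]
  refine Finset.sum_congr rfl fun e _ => ?_
  rw [← integral_add (integrable_skeletonL2 hd F e) (integrable_skeletonL2 hd G e)]
  exact integral_congr_ae (Lp.coeFn_add (F e) (G e))

theorem intE_smul (c : ℝ) (F : T.SkeletonL2) : intE (c • F) = c * intE F := by
  simp only [intE, Finset.mul_sum]
  refine Finset.sum_congr rfl fun e _ => ?_
  rw [← integral_const_mul]
  exact integral_congr_ae (Lp.coeFn_smul c (F e))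

theorem intE_zero : intE (0 : T.SkeletonL2) = 0 := by
  simpa using intE_smul 0 (0 : T.SkeletonL2)

theorem intE_sub (hd : 1 ≤ d) (F G : T.SkeletonL2) : intE (F - G) = intE F - intE G := by
  have h := intE_add hd F ((-1 : ℝ) • G)
  rw [intE_smul] at h
  simpa [sub_eq_add_neg] using h

theorem intJump_zero_scale (w : Fin d → T.BrokenPoly) : intJump (scale 0 w) = 0 := by
  simp [intJump, jump, scale, val]

end Integrals

section BoundaryConditions

theorem normalTrace_scale_velocity (u : T.BrokenPoly) (v : Fin d → T.fesZero p)
    (K : T.elements) (e : Finset (Pt d)) (he : e ∈ T.boundaryFacets)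
    (heK : e ⊆ (K : Finset (Pt d))) (x : Pt d) (hx : x ∈ convexHull ℝ (e : Set (Pt d))) :
    ∑ i, val (scale u (fun i => (v i : T.BrokenPoly)) i) K x *
      outwardNormal (K : Finset (Pt d)) e i = 0 := by
  refine Finset.sum_eq_zero fun i _ => ?_
  rw [scale, val_mul, (v i).2.2 K e he heK x hx, mul_zero, zero_mul]

theorem normalTrace_scale_normal (u : T.BrokenPoly) (q : T.fesNormal p)
    (K : T.elements) (e : Finset (Pt d)) (he : e ∈ T.boundaryFacets)
    (heK : e ⊆ (K : Finset (Pt d))) (x : Pt d) (hx : x ∈ convexHull ℝ (e : Set (Pt d))) :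
    ∑ i, val (scale u (q : Fin d → T.BrokenPoly) i) K x *
      outwardNormal (K : Finset (Pt d)) e i = 0 := by
  simp only [scale, val_mul, mul_assoc]
  rw [← Finset.mul_sum, q.2.2 K e he heK x hx, mul_zero]

end BoundaryConditions

/-! ### Affine trajectories as probes of the energy condition -/

section Trajectories

/-- The trajectory that moves affinely in time. -/
noncomputable def State.affine (X Y : T.State p) (t : ℝ) : T.State p where
  ρ := X.ρ + t • Y.ρ
  v := X.v + t • Y.v
  τ := X.τ + t • Y.τ
  q := X.q + t • Y.q

theorem hasTimeDeriv_affine (u w : T.BrokenPoly) (t : ℝ) :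
    HasTimeDeriv (fun s => u + s • w) w t := by
  intro K x
  simp only [val_add, val_smul]
  simpa using ((hasDerivAt_id t).mul_const (val w K x)).const_add (val u K x)

theorem isTrajectory_affine (X Y : T.State p) :
    IsTrajectory (X.affine Y) fun _ => Y.ρ :=
  ⟨fun t => hasTimeDeriv_affine _ _ t,
    fun t i => ⟨Y.vel i, hasTimeDeriv_affine (X.vel i) _ t⟩,
    fun t => ⟨Y.τ, hasTimeDeriv_affine _ _ t⟩,
    fun t i => ⟨(Y.q : Fin d → T.BrokenPoly) i,
      hasTimeDeriv_affine ((X.q : Fin d → T.BrokenPoly) i) _ t⟩⟩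

end Trajectories

/-! ### Consequences of the energy condition for the fluxes -/

namespace Fluxes

variable {F : T.Fluxes p} {γ tEnd : ℝ}

theorem intE_F4_add (hd : 1 ≤ d) (X : T.State p) (Z Z' : T.fesNormal p) :
    intE (F.F4 X (Z + Z')) = intE (F.F4 X Z) + intE (F.F4 X Z') := by
  rw [map_add, intE_add hd]

theorem intE_F4_smul (X : T.State p) (c : ℝ) (Z : T.fesNormal p) :
    intE (F.F4 X (c • Z)) = c * intE (F.F4 X Z) := by
  rw [map_smul, intE_smul]

/-- Constant density makes the F_3 term and the jump term vanish, and γ ≠ 0 can be divided out. -/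
theorem EnergyCondition.deriv_F4_eq_zero (hF : F.EnergyCondition γ tEnd) (hγ : γ ≠ 0)
    (X Y : T.State p) (hY : Y.ρ = 0) {t : ℝ} (ht : t ∈ Set.Icc 0 tEnd) :
    deriv (fun s => intE (F.F4 (X.affine Y s) (X.affine Y t).q)) t = 0 := by
  have h := (hF _ _ (isTrajectory_affine X Y) t ht).2.2
  rw [hY, map_zero, intE_zero, Submodule.coe_zero, intJump_zero_scale] at h
  simpa [hγ] using h

/-- The energy condition makes `∫_ℰ F_4(ρ, v, τ, q, q)` independent of the first copy of `q` and of
`v` and `τ`. -/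
theorem EnergyCondition.intE_F4_self (hF : F.EnergyCondition γ tEnd) (hT : 0 < tEnd)
    (hγ : γ ≠ 0) (X : T.State p) :
    intE (F.F4 X X.q) = intE (F.F4 ⟨X.ρ, 0, 0, 0⟩ X.q) := by
  let Y₀ : T.State p := ⟨X.ρ, 0, 0, 0⟩
  -- With this speed the path from (ρ, 0, 0, 0) reaches X exactly at time `tEnd`, inside the
  -- interval where the energy condition holds.
  let Y₁ : T.State p := ⟨0, tEnd⁻¹ • X.v, tEnd⁻¹ • X.τ, tEnd⁻¹ • X.q⟩
  let ψ : ℝ → ℝ := fun s => intE (F.F4 (Y₀.affine Y₁ s) X.q)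
  have hdiff : ∀ t ∈ Set.Icc 0 tEnd, DifferentiableAt ℝ ψ t := fun t ht =>
    (hF _ _ (isTrajectory_affine Y₀ Y₁) t ht).2.1 X.q
  obtain ⟨c, hc, hslope⟩ := exists_deriv_eq_slope ψ hT
    (fun t ht => (hdiff t ht).continuousAt.continuousWithinAt)
    (fun t ht => (hdiff t (Set.Ioo_subset_Icc_self ht)).differentiableWithinAt)
  have hd0 : deriv ψ c = 0 := by
    have h := hF.deriv_F4_eq_zero hγ Y₀ Y₁ rfl (Set.Ioo_subset_Icc_self hc)
    -- The frozen test function at time c is a multiple of `X.q`; the factor is nonzero since the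
    -- mean value theorem provides an interior point c > 0.
    have hq : (Y₀.affine Y₁ c).q = (c * tEnd⁻¹) • X.q := by
      simp [State.affine, Y₀, Y₁, smul_smul]
    simp only [hq, intE_F4_smul, deriv_const_mul_field] at h
    exact (mul_eq_zero.1 h).resolve_left (mul_pos hc.1 (inv_pos.2 hT)).ne'
  rw [hd0, eq_comm, div_eq_zero_iff, sub_zero, or_iff_left hT.ne', sub_eq_zero] at hslope
  have h1 : Y₀.affine Y₁ tEnd = X := by
    simp [State.affine, Y₀, Y₁, smul_smul, hT.ne']
  have h0 : Y₀.affine Y₁ 0 = Y₀ := by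
    simp [State.affine, Y₀]
  simpa only [ψ, h1, h0] using hslope

/-- The energy condition makes `∫_ℰ F_4(ρ, v, τ, q, Z)` independent of `v`, `τ` and `q`. -/
theorem EnergyCondition.intE_F4_eq (hd : 1 ≤ d) (hF : F.EnergyCondition γ tEnd)
    (hT : 0 < tEnd) (hγ : γ ≠ 0) (X : T.State p) (Z : T.fesNormal p) :
    intE (F.F4 X Z) = intE (F.F4 ⟨X.ρ, 0, 0, 0⟩ Z) := by
  -- Polarisation: `q` is perturbed by sZ, the preceding identity is applied along the perturbation,
  -- and the result is differentiated at s = 0.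
  let Y : T.State p := ⟨0, 0, 0, Z⟩
  have h0 : X.affine Y 0 = X := by simp [State.affine]
  have hmem : (0 : ℝ) ∈ Set.Icc 0 tEnd := ⟨le_rfl, hT.le⟩
  have hE := hF _ _ (isTrajectory_affine X Y) 0 hmem
  have hq0 : deriv (fun s => intE (F.F4 (X.affine Y s) X.q)) 0 = 0 := by
    have h := hF.deriv_F4_eq_zero hγ X Y rfl hmem
    rwa [h0] at h
  have e1 : ∀ s, intE (F.F4 (X.affine Y s) X.q) + s * intE (F.F4 (X.affine Y s) Z) =
      intE (F.F4 ⟨X.ρ, 0, 0, 0⟩ X.q) + s * intE (F.F4 ⟨X.ρ, 0, 0, 0⟩ Z) := fun s => by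
    have h := hF.intE_F4_self hT hγ (X.affine Y s)
    have hρ : (X.affine Y s).ρ = X.ρ := by simp [State.affine, Y]
    have hq : (X.affine Y s).q = X.q + s • Z := rfl
    rw [hρ, hq, intE_F4_add hd, intE_F4_add hd, intE_F4_smul, intE_F4_smul] at h
    exact h
  -- By the product rule at s = 0, the unknown derivative of the Z-term is multiplied by 0, and the
  -- derivative of the other term is 0 by `hq0`. Only F_4 at X tested with Z survives.
  have d1 : HasDerivAt (fun s => intE (F.F4 (X.affine Y s) X.q) +
      s * intE (F.F4 (X.affine Y s) Z)) (0 + (1 * intE (F.F4 (X.affine Y 0) Z) +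
        0 * deriv (fun s => intE (F.F4 (X.affine Y s) Z)) 0)) 0 := by
    have ha := (hE.2.1 X.q).hasDerivAt
    rw [hq0] at ha
    exact ha.add ((hasDerivAt_id (0 : ℝ)).mul (hE.2.1 Z).hasDerivAt)
  have d2 : HasDerivAt (fun s => intE (F.F4 (X.affine Y s) X.q) +
      s * intE (F.F4 (X.affine Y s) Z)) (1 * intE (F.F4 ⟨X.ρ, 0, 0, 0⟩ Z)) 0 := by
    simp only [e1]
    exact ((hasDerivAt_id (0 : ℝ)).mul_const _).const_add _
  simpa [h0] using d1.unique d2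

/-- The discrete chain rule for the fluxes of the potential and gradient equations. -/
theorem EnergyCondition.F3_sub_F4 (hd : 1 ≤ d) (hF : F.EnergyCondition γ tEnd) (hT : 0 < tEnd)
    (hF4 : ∀ v τ q ζ, IsLinearMap ℝ (fun ρ : T.fes p => F.F4 ⟨ρ, v, τ, q⟩ ζ))
    (X Y M : T.State p) :
    intE (F.F3 M (Y.ρ - X.ρ)) - γ * (intE (F.F4 Y M.q) - intE (F.F4 X M.q)) +
      γ * intJump (scale (Y.ρ - X.ρ : T.BrokenPoly) M.q) = 0 := by
  -- Through M at time 0, the density moves with velocity equal to the increment and all else is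
  -- frozen.
  let D : T.State p := ⟨Y.ρ - X.ρ, 0, 0, 0⟩
  have h0 : M.affine D 0 = M := by simp [State.affine]
  have hE := (hF _ _ (isTrajectory_affine M D) 0 ⟨le_rfl, hT.le⟩).2.2
  rw [h0] at hE
  -- For γ = 0 both the F_4 and the jump term carry the factor γ, so independence from v, τ, q,
  -- which is unavailable then, is not needed.
  rcases eq_or_ne γ 0 with rfl | hγ
  · simpa [D] using hE
  have hlin : ∀ s, intE (F.F4 (M.affine D s) M.q) =
      intE (F.F4 M M.q) + s * (intE (F.F4 Y M.q) - intE (F.F4 X M.q)) := fun s => by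
    have hs : (M.affine D s).ρ = M.ρ + s • (Y.ρ - X.ρ) := rfl
    have hl := hF4 0 0 0 M.q
    rw [hF.intE_F4_eq hd hT hγ, hF.intE_F4_eq hd hT hγ M, hF.intE_F4_eq hd hT hγ Y,
      hF.intE_F4_eq hd hT hγ X, hs, hl.map_add, hl.map_smul, hl.map_sub, intE_add hd, intE_smul,
      intE_sub hd]
  have hderiv : deriv (fun s => intE (F.F4 (M.affine D s) M.q)) 0 =
      intE (F.F4 Y M.q) - intE (F.F4 X M.q) := by
    simp only [hlin]
    simp
  rw [hderiv] at hE
  exact hE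

theorem EnergyCondition.F1_add_F2 (hF : F.EnergyCondition γ tEnd) (hT : 0 < tEnd)
    (M : T.State p) :
    intE (F.F1 M M.τ) + intE (F.F2 M M.v) +
      intJump (scale (M.ρ * M.τ : T.BrokenPoly) M.vel) = 0 := by
  have h0 : M.affine ⟨0, 0, 0, 0⟩ 0 = M := by simp [State.affine]
  have hE := (hF _ _ (isTrajectory_affine M ⟨0, 0, 0, 0⟩) 0 ⟨le_rfl, hT.le⟩).1
  rwa [h0] at hE

end Fluxes

/-! ### Mass and energy balance of one time step -/

section OneStep

variable {F : T.Fluxes p} {X Y : T.State p}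

theorem mass_eq_of_massEq (hd : 1 ≤ d) (hF : F.MassCondition) {k : ℝ} (hk : k ≠ 0)
    (h : MassEq F k X Y) : Y.mass = X.mass := by
  have h1 := h (T.one p)
  rw [hF (X.half Y)] at h1
  have hdiv := intΩ_div_eq_intJump hd (scale ((X.half Y).ρ : T.BrokenPoly) (X.half Y).vel)
    (normalTrace_scale_velocity _ (X.half Y).v)
  rw [← hdiv] at h1
  have hone : ((T.one p : T.fes p) : T.BrokenPoly) = 1 := rfl
  rw [hone, mul_one] at h1
  have hsplit : T.intΩ (val ((1 / k) • ((Y.ρ : T.BrokenPoly) - X.ρ) +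
        div (scale ((X.half Y).ρ : T.BrokenPoly) (X.half Y).vel))) =
      1 / k * (T.intΩ (val (Y.ρ : T.BrokenPoly)) - T.intΩ (val (X.ρ : T.BrokenPoly))) +
        T.intΩ (val (div (scale ((X.half Y).ρ : T.BrokenPoly) (X.half Y).vel))) := by
    rw [← intΩ_sub (continuous_val _) (continuous_val _), ← intΩ_const_mul,
      ← intΩ_add (fun K => by fun_prop) (continuous_val _)]
    congr 1
    funext K x
    rw [val_add, val_smul, val_sub]
  rw [hsplit, add_neg_cancel_right, mul_eq_zero, or_iff_right (one_div_ne_zero hk),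
    sub_eq_zero] at h1
  exact h1

/-- The momentum integrand tested with v, where `Dv i j` stands for ∂_i v_j. The convective terms
cancel, leaving the inertial term and ρ v·∇τ. -/
theorem sum_momentum_mul_velocity (ρ c : ℝ) (v v' Dρ Dτ : Fin d → ℝ) (Dv : Fin d → Fin d → ℝ) :
    ∑ j, (ρ * (c * v' j) + (∑ i, (ρ * v i * Dv i j + v j * (ρ * Dv i i + v i * Dρ i))) -
        (∑ i, (ρ * Dv i i + v i * Dρ i)) * v j + ρ * Dτ j -
        1 / 2 * (ρ * ∑ i, (v i * Dv j i + v i * Dv j i))) * v j =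
      c * ρ * (∑ j, v' j * v j) + ρ * ∑ j, v j * Dτ j := by
  have hconv : ∑ j, (∑ i, ρ * v i * Dv i j) * v j =
      ∑ j, 1 / 2 * (ρ * ∑ i, (v i * Dv j i + v i * Dv j i)) * v j := by
    simp only [Finset.sum_mul, Finset.mul_sum]
    rw [Finset.sum_comm]
    exact Finset.sum_congr rfl fun i _ => Finset.sum_congr rfl fun j _ => by ring
  have hsplit : ∀ j, (ρ * (c * v' j) +
      (∑ i, (ρ * v i * Dv i j + v j * (ρ * Dv i i + v i * Dρ i))) -
        (∑ i, (ρ * Dv i i + v i * Dρ i)) * v j + ρ * Dτ j -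
        1 / 2 * (ρ * ∑ i, (v i * Dv j i + v i * Dv j i))) * v j =
      c * ρ * (v' j * v j) + ρ * (v j * Dτ j) + ((∑ i, ρ * v i * Dv i j) * v j -
        1 / 2 * (ρ * ∑ i, (v i * Dv j i + v i * Dv j i)) * v j) := fun j => by
    rw [Finset.sum_add_distrib, ← Finset.mul_sum]
    ring
  rw [Finset.sum_congr rfl fun j _ => hsplit j, Finset.sum_add_distrib, Finset.sum_add_distrib,
    Finset.sum_sub_distrib, hconv, sub_self, add_zero, ← Finset.mul_sum, ← Finset.mul_sum]

/-- Used for v and for q: midpoint averaging makes the increment of the square exact, without time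
discretisation error. -/
theorem sum_sub_mul_half (a b : Fin d → ℝ) :
    ∑ i, (b i - a i) * (1 / 2 * (a i + b i)) = 1 / 2 * (∑ i, b i * b i - ∑ i, a i * a i) := by
  rw [← Finset.sum_sub_distrib, Finset.mul_sum]
  exact Finset.sum_congr rfl fun i _ => by ring

/-- The energy balance, from the tested equations of the scheme and a pointwise identity between
the integrands. -/
theorem intΩ_sub_eq_of_pointwise {e e' f₁ f₂ f₃ g g' s₁ s₂ : T.elements → Pt d → ℝ}
    {k γ a₁ a₂ a₃ l l' b : ℝ}
    (h₁ : T.intΩ f₁ + a₁ = 0) (h₂ : T.intΩ f₂ + a₂ + b = 0) (h₃ : T.intΩ f₃ + a₃ = 0)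
    (hg : T.intΩ g + l = 0) (hg' : T.intΩ g' + l' = 0)
    (c₁ : a₁ + a₂ + T.intΩ s₁ = 0) (c₂ : a₃ - γ * (l' - l) + γ * T.intΩ s₂ = 0)
    (he : ∀ K, Continuous (e K)) (he' : ∀ K, Continuous (e' K))
    (hf₁ : ∀ K, Continuous (f₁ K)) (hf₂ : ∀ K, Continuous (f₂ K)) (hf₃ : ∀ K, Continuous (f₃ K))
    (hgc : ∀ K, Continuous (g K)) (hgc' : ∀ K, Continuous (g' K))
    (hs₁ : ∀ K, Continuous (s₁ K)) (hs₂ : ∀ K, Continuous (s₂ K))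
    (hpt : ∀ K x, e' K x - e K x = k * (f₁ K x + f₂ K x - s₁ K x) - f₃ K x +
      γ * (g' K x - g K x + s₂ K x)) :
    T.intΩ e' - T.intΩ e = -k * b := by
  have hfun : (fun K x => e' K x - e K x) = fun K x => k * (f₁ K x + f₂ K x - s₁ K x) - f₃ K x +
      γ * (g' K x - g K x + s₂ K x) := funext fun K => funext fun x => hpt K x
  have h := congrArg T.intΩ hfun
  rw [intΩ_sub he' he, intΩ_add (fun K => by fun_prop) (fun K => by fun_prop),
    intΩ_sub (fun K => by fun_prop) hf₃, intΩ_const_mul, intΩ_const_mul,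
    intΩ_sub (fun K => by fun_prop) hs₁, intΩ_add hf₁ hf₂,
    intΩ_add (fun K => by fun_prop) hs₂, intΩ_sub hgc' hgc] at h
  -- The tested equations trade integrals for flux terms; `c₁` and `c₂` remove these, so only b
  -- remains.
  linear_combination h + k * h₁ + k * h₂ - h₃ - γ * hg + γ * hg' - k * c₁ + c₂

theorem energy_sub_energy (hd : 1 ≤ d) {W : ℝ → ℝ} (hW : Continuous W) {μ γ k tEnd : ℝ}
    (hk : k ≠ 0) (hT : 0 < tEnd) (hF : F.EnergyCondition γ tEnd)
    (hF4 : ∀ v τ q ζ, IsLinearMap ℝ (fun ρ : T.fes p => F.F4 ⟨ρ, v, τ, q⟩ ζ))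
    {B : LinearMap.BilinForm ℝ (Fin d → T.fesZero p)}
    (h1 : MassEq F k X Y) (h2 : MomentumEq F B μ k X Y) (h3 : PotentialEq F W γ X Y)
    (hX : GradientEq F X) (hY : GradientEq F Y) :
    Y.energy W γ - X.energy W γ = -μ * k * B (X.half Y).v (X.half Y).v := by
  set M := X.half Y with hM
  have m1 := h1 M.τ
  have m2 := h2 M.v
  have m3 := h3 (Y.ρ - X.ρ)
  have gX := hX M.q
  have gY := hY M.q
  rw [← hM] at m1 m2 m3
  have j1 := intΩ_div_eq_intJump hd (scale (M.ρ * M.τ : T.BrokenPoly) M.vel)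
    (normalTrace_scale_velocity _ M.v)
  have j2 := intΩ_div_eq_intJump hd (scale (Y.ρ - X.ρ : T.BrokenPoly) M.q)
    (normalTrace_scale_normal _ M.q)
  have c1 := hF.F1_add_F2 hT M
  have c2 := hF.F3_sub_F4 hd hT hF4 X Y M
  rw [← j1] at c1
  rw [← j2] at c2
  clear j1 j2
  -- Multiplying by the density increment clears the difference quotient, also where the increment
  -- is 0. The integrand becomes visibly continuous, which the splitting of integrals requires.
  have hpot : ∀ (K : T.elements) (x : Pt d),
      (val (M.τ : T.BrokenPoly) K x
        - dslope W (val (X.ρ : T.BrokenPoly) K x) (val (Y.ρ : T.BrokenPoly) K x)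
        + γ * val (div (M.q : Fin d → T.BrokenPoly)) K x
        - 1 / 4 * ((∑ i, val (Y.vel i) K x ^ 2) + ∑ i, val (X.vel i) K x ^ 2))
        * val ((Y.ρ - X.ρ : T.fes p) : T.BrokenPoly) K x =
      (val (M.τ : T.BrokenPoly) K x + γ * val (div (M.q : Fin d → T.BrokenPoly)) K x
        - 1 / 4 * ((∑ i, val (Y.vel i) K x ^ 2) + ∑ i, val (X.vel i) K x ^ 2))
        * (val (Y.ρ : T.BrokenPoly) K x - val (X.ρ : T.BrokenPoly) K x)
        - (W (val (Y.ρ : T.BrokenPoly) K x) - W (val (X.ρ : T.BrokenPoly) K x)) := by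
    intro K x
    have hs := sub_smul_dslope W (val (X.ρ : T.BrokenPoly) K x) (val (Y.ρ : T.BrokenPoly) K x)
    rw [smul_eq_mul] at hs
    rw [Submodule.coe_sub, val_sub, ← hs]
    ring
  simp only [hpot] at m3
  simp only [State.energy]
  refine (intΩ_sub_eq_of_pointwise (k := k) m1 m2 m3 gX gY c1 c2 (fun K => by fun_prop)
    (fun K => by fun_prop) (fun K => continuous_val _ K) (fun K => continuous_val _ K)
    (fun K => by fun_prop) (fun K => continuous_val _ K) (fun K => continuous_val _ K)
    (fun K => continuous_val _ K) (fun K => continuous_val _ K) ?_).trans (by ring)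
  intro K x
  have hρ : val (M.ρ : T.BrokenPoly) K x =
      1 / 2 * (val (X.ρ : T.BrokenPoly) K x + val (Y.ρ : T.BrokenPoly) K x) := by
    rw [← val_add, ← val_smul]; rfl
  have hv : ∀ i, val (M.vel i) K x = 1 / 2 * (val (X.vel i) K x + val (Y.vel i) K x) := fun i => by
    rw [← val_add, ← val_smul]; rfl
  have hq : ∀ i, val ((M.q : Fin d → T.BrokenPoly) i) K x =
      1 / 2 * (val ((X.q : Fin d → T.BrokenPoly) i) K x +
        val ((Y.q : Fin d → T.BrokenPoly) i) K x) := fun i => by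
    rw [← val_add, ← val_smul]; rfl
  have hMv : ∀ i, ((M.v i : T.fesZero p) : T.BrokenPoly) = M.vel i := fun _ => rfl
  simp only [div, scale, pow_two, dx_sum, dx_mul, dx_sub, val_sum, val_add, val_sub, val_mul,
    val_smul, hMv]
  rw [sum_momentum_mul_velocity (val (M.ρ : T.BrokenPoly) K x) (1 / k)
    (fun i => val (M.vel i) K x) (fun i => val (Y.vel i) K x - val (X.vel i) K x)
    (fun i => val (dx i (M.ρ : T.BrokenPoly)) K x) (fun i => val (dx i (M.τ : T.BrokenPoly)) K x)
    (fun i j => val (dx i (M.vel j)) K x)]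
  have s1 := sum_sub_mul_half (fun i => val (X.vel i) K x) (fun i => val (Y.vel i) K x)
  have s2 := sum_sub_mul_half (fun i => val ((X.q : Fin d → T.BrokenPoly) i) K x)
    (fun i => val ((Y.q : Fin d → T.BrokenPoly) i) K x)
  simp only [← hv, ← hq] at s1 s2
  rw [s1]
  have t1 := fun (r τ : ℝ) (v Dv Dρ Dτ : Fin d → ℝ) =>
    show ∑ i, (r * τ * Dv i + v i * (r * Dτ i + τ * Dρ i)) =
        (∑ i, (r * Dv i + v i * Dρ i)) * τ + r * ∑ i, v i * Dτ i by
      rw [Finset.sum_mul, Finset.mul_sum, ← Finset.sum_add_distrib]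
      exact Finset.sum_congr rfl fun i _ => by ring
  -- The gradient of the density increment cancels between the gradient equations and div(δρ q); the
  -- remaining δρ div q cancels against the potential equation.
  have t2 := fun (r : ℝ) (a a' b b' q Dq : Fin d → ℝ) =>
    show ∑ i, (a' i - b' i) * q i - ∑ i, (a i - b i) * q i +
        ∑ i, (r * Dq i + q i * (b' i - b i)) = ∑ i, (a' i - a i) * q i + r * ∑ i, Dq i by
      rw [Finset.mul_sum, ← Finset.sum_sub_distrib, ← Finset.sum_add_distrib,
        ← Finset.sum_add_distrib]
      exact Finset.sum_congr rfl fun i _ => by ring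
  rw [t1, t2, s2]
  have hk1 : k * (1 / k) = 1 := mul_one_div_cancel hk
  generalize val (M.ρ : T.BrokenPoly) K x = r at hρ ⊢
  -- A scalar identity is left: `hk1` cancels the step length, and `hρ` supplies the average in the
  -- discrete product rule δ(½ρ|v|²) = ½ ρ δ|v|² + ½ δρ · average of |v|².
  linear_combination (-(val (Y.ρ : T.BrokenPoly) K x - val (X.ρ : T.BrokenPoly) K x) *
    val (M.τ : T.BrokenPoly) K x - r * (1 / 2 * (∑ i, val (Y.vel i) K x * val (Y.vel i) K x -
      ∑ i, val (X.vel i) K x * val (X.vel i) K x))) * hk1 -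
    1 / 2 * (∑ i, val (Y.vel i) K x * val (Y.vel i) K x -
      ∑ i, val (X.vel i) K x * val (X.vel i) K x) * hρ

end OneStep

end Triangulation

end NSK

end

/-! ### Assembly over all time steps -/

theorem theorem5p1 {d : ℕ} (hd : 1 ≤ d) {Ω : Set (NSK.Pt d)} (hΩ : IsOpen Ω)
    (hΩc : IsConnected Ω) (hΩb : Bornology.IsBounded Ω)
    (T : NSK.Triangulation Ω) (p : ℕ) (W : ℝ → ℝ) (hW : ContDiff ℝ 1 W) (μ γ : ℝ)
    (F : T.Fluxes p) (B : LinearMap.BilinForm ℝ (Fin d → T.fesZero p))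
    (N : ℕ) (t : ℕ → ℝ) (ht0 : t 0 = 0) (ht : ∀ n < N, t n < t (n + 1))
    (hmass : F.MassCondition) (henergy : F.EnergyCondition γ (t N))
    (hF4 : ∀ v τ q ζ, IsLinearMap ℝ (fun ρ : T.fes p => F.F4 ⟨ρ, v, τ, q⟩ ζ))
    (X : ℕ → T.State p)
    (hX : NSK.Triangulation.IsSolution F B W μ γ N t X) :
    (∀ n ≤ N, (X n).mass = (X 0).mass) ∧
    (∀ n < N, (n = 0 → NSK.Triangulation.GradientEq F (X 0)) →
      (X (n + 1)).energy W γ - (X n).energy W γ =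
        -μ * (t (n + 1) - t n) * B ((X n).half (X (n + 1))).v ((X n).half (X (n + 1))).v) := by
  have hpos : ∀ n < N, t (n + 1) - t n ≠ 0 := fun n hn => (sub_pos.2 (ht n hn)).ne'
  refine ⟨fun n => ?_, fun n hn h0 => ?_⟩
  · induction n with
    | zero => exact fun _ => rfl
    | succ n ih =>
      intro hn
      rw [NSK.Triangulation.mass_eq_of_massEq hd hmass (hpos n hn) (hX n hn).1]
      exact ih (Nat.le_of_succ_le hn)
  · have hmono : ∀ m ≤ N, 0 ≤ t m := by
      intro m
      induction m with
      | zero => exact fun _ => ht0.ge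
      | succ m ih => exact fun hm => (ih (Nat.le_of_succ_le hm)).trans (ht m hm).le
    -- The mean value argument for F_4 needs a time interval of positive length.
    have hN : 0 < t N := by
      obtain ⟨m, rfl⟩ : ∃ m, N = m + 1 := ⟨N - 1, by omega⟩
      exact (hmono m (Nat.le_succ m)).trans_lt (ht m (Nat.lt_succ_self m))
    obtain ⟨h1, h2, h3, h4⟩ := hX n hn
    have hgrad : NSK.Triangulation.GradientEq F (X n) := by
      -- For n > 0 the gradient equation at level n comes from the preceding step; only at n = 0 is
      -- it an assumption on the initial data.
      rcases n with _ | n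
      · exact h0 rfl
      · exact (hX n (Nat.lt_of_succ_lt hn)).2.2.2
    exact NSK.Triangulation.energy_sub_energy hd hW.continuous (hpos n hn) hN henergy hF4
      h1 h2 h3 hgrad h4
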